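/- There is a symmetric probability distribution $\mu$ on the integers such that the following holds. Let $(X_i)_{i\ge 1}$ and $(\tilde X_i)_{i\ge 1}$ be two independent sequences of i.i.d. random variables with law $\mu$, defined on any common probability space, and let $S_n=\sum_{i=1}^n X_i$, $\tilde S_n=\sum_{i=1}^n\tilde X_i$ (with $S_0=\tilde S_0=0$) be the associated random walks. Then: (a) the two-dimensional random walk $(S_n,\tilde S_n)$ is transient, i.e. every bounded subset of $\mathbb{Z}^2$ is almost surely visited only finitely often; (b) almost surely, for infinitely many $n$ one has $S_nS_{n+1}<0$ and $\tilde S_n=\tilde S_{n+1}=0$. In particular, $$\sum_{n=1}^\infty P(S_n=0)^2<\infty\qquad\text{and}\qquad \sum_{n=1}^\infty P(S_n=0)\,P(S_nS_{n+1}<0)=\infty .$$ -/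

import Mathlib

open MeasureTheory ProbabilityTheory Filter

/-- `X 0, X 1, …` are independent integer-valued random variables, each with law `μ`. -/
structure IsIIDWithLaw {Ω : Type*} [MeasurableSpace Ω] (X : ℕ → Ω → ℤ) (μ : Measure ℤ)
    (P : Measure Ω) : Prop where
  measurable : ∀ i, Measurable (X i)
  indep : iIndepFun X P
  law : ∀ i, P.map (X i) = μ

/-- The walk started at `0` with steps `X 0, X 1, …`, that is `S_n = X 0 + … + X (n - 1)`. -/
def walk {Ω : Type*} (X : ℕ → Ω → ℤ) (n : ℕ) (ω : Ω) : ℤ :=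
  ∑ i ∈ Finset.range n, X i ω

/-- A process is transient if every bounded set is almost surely visited only finitely often. -/
def IsTransient {Ω E : Type*} [MeasurableSpace Ω] [Bornology E] (W : ℕ → Ω → E)
    (P : Measure Ω) : Prop :=
  ∀ B : Set E, Bornology.IsBounded B → ∀ᵐ ω ∂P, {n : ℕ | W n ω ∈ B}.Finite

open scoped ENNReal

/-! ### The transition operator of a random walk on the integers -/

/-! The step law mixes jump laws indexed by scales `d = scale k`: at rate about `1/d` the walk makes
a jump of size about `d^5`, so this scale contributes variance about `d^9` per step. For `n` between
`d^2` and a quarter of the next scale, many jumps of scale `k` are expected, and with probability at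
least 3/4 there is none of a larger scale. Once `d` is large, the probability of `S_n = x` is
therefore of order `(n d^9)^(-1/2)` for all `|x| ≤ 2 d^5`. The upper half is `hit_le`, which stays
valid at later times, and the lower half is `le_hit`.

The next scale is exponential in `d^8`, so the sum of `1/n` over the times belonging to scale `k` is
of order `d^8`. Squared return probabilities add up to `O(d^8/d^9) = O(1/d)` there, which is
summable over `k` (`tsum_hit_sq_lt_top`), and Borel–Cantelli gives transience. A crossing asks less
of the first walk: it may be anywhere in `(0, d^5]`, provided that it then jumps below `-d^5`, an
event of probability at least of order `1/d`. This gains a factor `d^5/d = d^4` over a return to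
zero. Even if only multiples of `d^2` are sampled, the expected number of crossings is at least of
order `d^4 * d^(-9) * d^(-2) * d^8 = d`.

Pairs of sampled crossings obey an upper bound of the same shape, so the second moment method yields
a crossing with probability at least `crossConst` at every large scale, uniformly over starting
points of size at most `d^5` (`le_real_iUnion_jumpOver`). Hence from every starting point there are
infinitely many crossings with probability at least `crossConst`, and Lévy's zero-one law raises
this to one. The divergent series follows from Borel–Cantelli.

Two devices make the local estimates elementary. A jump is a uniform variable plus a centred
binomial multiple of the window length, so sums of jumps are controlled by central binomial
coefficients. All laws involved are symmetric unimodal, which turns Chebyshev's inequality into a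
pointwise lower bound. -/

/-- The transition operator of the random walk with step law `ν`. -/
noncomputable def stepOp (ν : Measure ℤ) (f : ℤ → ℝ≥0∞) (x : ℤ) : ℝ≥0∞ :=
  ∫⁻ v, f (x + v) ∂ν

lemma stepOp_mono {ν κ : Measure ℤ} {f g : ℤ → ℝ≥0∞} (h : ν ≤ κ) (hfg : f ≤ g) :
    stepOp ν f ≤ stepOp κ g :=
  fun x => lintegral_mono' h fun v => hfg (x + v)

lemma stepOp_iterate_mono {ν κ : Measure ℤ} {f g : ℤ → ℝ≥0∞} (h : ν ≤ κ) (hfg : f ≤ g) (n : ℕ) :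
    (stepOp ν)^[n] f ≤ (stepOp κ)^[n] g := by
  induction n with
  | zero => exact hfg
  | succ n ih =>
    rw [Function.iterate_succ_apply', Function.iterate_succ_apply']
    exact stepOp_mono h ih

lemma stepOp_add (ν : Measure ℤ) (f g : ℤ → ℝ≥0∞) :
    stepOp ν (f + g) = stepOp ν f + stepOp ν g := by
  funext x
  exact lintegral_add_left (Measurable.of_discrete) _

lemma stepOp_smul (ν : Measure ℤ) (c : ℝ≥0∞) (f : ℤ → ℝ≥0∞) :
    stepOp ν (c • f) = c • stepOp ν f := by
  funext x
  exact lintegral_const_mul c (Measurable.of_discrete)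

lemma stepOp_iterate_add (ν : Measure ℤ) (f g : ℤ → ℝ≥0∞) (n : ℕ) :
    (stepOp ν)^[n] (f + g) = (stepOp ν)^[n] f + (stepOp ν)^[n] g := by
  induction n with
  | zero => rfl
  | succ n ih => simp only [Function.iterate_succ_apply', ih, stepOp_add]

lemma stepOp_zero (ν : Measure ℤ) : stepOp ν 0 = 0 := by
  funext x; simp [stepOp]

lemma stepOp_iterate_zero (ν : Measure ℤ) (n : ℕ) : (stepOp ν)^[n] 0 = 0 := by
  induction n with
  | zero => rfl
  | succ n ih => simp only [Function.iterate_succ_apply', ih, stepOp_zero]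

lemma stepOp_iterate_sum (ν : Measure ℤ) {ι : Type*} (s : Finset ι) (f : ι → ℤ → ℝ≥0∞) (n : ℕ) :
    (stepOp ν)^[n] (∑ i ∈ s, f i) = ∑ i ∈ s, (stepOp ν)^[n] (f i) := by
  classical
  induction s using Finset.induction_on with
  | empty => simp [stepOp_iterate_zero]
  | insert a s ha ih => rw [Finset.sum_insert ha, Finset.sum_insert ha, stepOp_iterate_add, ih]

/-- By Tonelli. This lets the jumps of one chosen scale be collected, whatever the times at which
they occur. -/
lemma stepOp_comm (ν κ : Measure ℤ) [SFinite ν] [SFinite κ] :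
    Function.Commute (stepOp ν) (stepOp κ) := by
  intro f
  funext x
  simp only [stepOp]
  rw [lintegral_lintegral_swap (Measurable.of_discrete).aemeasurable]
  exact lintegral_congr fun u => lintegral_congr fun v => by rw [add_right_comm]

lemma stepOp_le_of_le (ν : Measure ℤ) {f : ℤ → ℝ≥0∞} {c : ℝ≥0∞} (h : ∀ x, f x ≤ c) (x : ℤ) :
    stepOp ν f x ≤ c * ν Set.univ :=
  (lintegral_mono fun v => h (x + v)).trans_eq (lintegral_const c)

lemma stepOp_iterate_le_of_le (ν : Measure ℤ) [IsProbabilityMeasure ν] {f : ℤ → ℝ≥0∞} {c : ℝ≥0∞}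
    (h : ∀ x, f x ≤ c) (n : ℕ) (x : ℤ) : (stepOp ν)^[n] f x ≤ c := by
  induction n generalizing x with
  | zero => exact h x
  | succ n ih =>
    rw [Function.iterate_succ_apply']
    simpa using stepOp_le_of_le ν ih x

lemma stepOp_iterate_translate (ν : Measure ℤ) (f : ℤ → ℝ≥0∞) (z : ℤ) (n : ℕ) (x : ℤ) :
    (stepOp ν)^[n] (fun y => f (y + z)) x = (stepOp ν)^[n] f (x + z) := by
  induction n generalizing x with
  | zero => rfl
  | succ n ih =>
    simp only [Function.iterate_succ_apply', stepOp, ih]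
    simp only [add_right_comm]

/-- The indicator of a set of integers, as an extended nonnegative function. -/
noncomputable def ind (A : Set ℤ) : ℤ → ℝ≥0∞ := A.indicator 1

lemma ind_le_one (A : Set ℤ) (x : ℤ) : ind A x ≤ 1 := Set.indicator_le_self' (by simp) x

/-- The probability that the walk with step law `ν` started from `x` is at `0` at time `n`. -/
noncomputable def hit (ν : Measure ℤ) (n : ℕ) : ℤ → ℝ≥0∞ := (stepOp ν)^[n] (ind {0})

lemma hit_succ (ν : Measure ℤ) (n : ℕ) : hit ν (n + 1) = stepOp ν (hit ν n) :=
  Function.iterate_succ_apply' _ _ _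

lemma hit_le_one (ν : Measure ℤ) [IsProbabilityMeasure ν] (n : ℕ) (x : ℤ) : hit ν n x ≤ 1 :=
  stepOp_iterate_le_of_le ν (ind_le_one _) n x

lemma stepOp_iterate_ind_finset (ν : Measure ℤ) (s : Finset ℤ) (n : ℕ) (x : ℤ) :
    (stepOp ν)^[n] (ind s) x = ∑ z ∈ s, hit ν n (x - z) := by
  have h : ind (s : Set ℤ) = ∑ z ∈ s, fun y => ind {0} (y + -z) := by
    funext y
    rw [Finset.sum_apply]
    simp [ind, Set.indicator_apply, add_neg_eq_zero]
  rw [h, stepOp_iterate_sum, Finset.sum_apply]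
  refine Finset.sum_congr rfl fun z _ => ?_
  rw [stepOp_iterate_translate, hit, sub_eq_add_neg]

/-! ### Independence and the Markov property -/

section Markov

variable {Ω : Type*} [MeasurableSpace Ω] {P : Measure Ω}

lemma lintegral_indepFun [IsProbabilityMeasure P] {α β : Type*} [MeasurableSpace α]
    [MeasurableSpace β] {U : Ω → α} {V : Ω → β} (hU : Measurable U) (hV : Measurable V)
    (h : IndepFun U V P) {g : α → β → ℝ≥0∞} (hg : Measurable (Function.uncurry g)) :
    ∫⁻ ω, g (U ω) (V ω) ∂P = ∫⁻ ω, ∫⁻ v, g (U ω) v ∂(P.map V) ∂P := by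
  have : IsProbabilityMeasure (P.map V) := Measure.isProbabilityMeasure_map hV.aemeasurable
  have : IsProbabilityMeasure (P.map U) := Measure.isProbabilityMeasure_map hU.aemeasurable
  have h1 := (indepFun_iff_map_prod_eq_prod_map_map hU.aemeasurable hV.aemeasurable).1 h
  calc ∫⁻ ω, g (U ω) (V ω) ∂P
      = ∫⁻ z, Function.uncurry g z ∂(P.map fun ω => (U ω, V ω)) :=
        (lintegral_map hg (hU.prodMk hV)).symm
    _ = ∫⁻ u, ∫⁻ v, g u v ∂(P.map V) ∂(P.map U) := by
        rw [h1, lintegral_prod _ hg.aemeasurable]; rfl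
    _ = _ := lintegral_map hg.lintegral_prod_right' hU

/-- The information carried by `X 0, …, X (n - 1)`. -/
@[reducible] def past {β : Type*} [m : MeasurableSpace β] (X : ℕ → Ω → β) (n : ℕ) : MeasurableSpace Ω :=
  ⨆ i ∈ Set.Iio n, m.comap (X i)

/-- The information carried by `X n, X (n + 1), …`. -/
@[reducible] def future {β : Type*} [m : MeasurableSpace β] (X : ℕ → Ω → β) (n : ℕ) : MeasurableSpace Ω :=
  ⨆ i ∈ Set.Ici n, m.comap (X i)

section

variable {β : Type*} [MeasurableSpace β] {X : ℕ → Ω → β}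

lemma past_le (hX : ∀ i, Measurable (X i)) (n : ℕ) : past X n ≤ ‹MeasurableSpace Ω› :=
  iSup₂_le fun i _ => (hX i).comap_le

lemma past_mono : Monotone (past X) := fun _ _ h =>
  biSup_mono fun _ hi => lt_of_lt_of_le hi h

lemma measurable_past {i n : ℕ} (h : i < n) : Measurable[past X n] (X i) :=
  Measurable.of_comap_le (le_iSup₂_of_le i h le_rfl)

lemma measurable_future {i n : ℕ} (h : n ≤ i) : Measurable[future X n] (X i) :=
  Measurable.of_comap_le (le_iSup₂_of_le i h le_rfl)

lemma indep_past_future (hX : ∀ i, Measurable (X i)) (h : iIndepFun X P) (n : ℕ) :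
    Indep (past X n) (future X n) P :=
  indep_iSup_of_disjoint (fun i => (hX i).comap_le) h
    (Set.disjoint_left.2 fun _ h1 h2 => (not_le.2 (Set.mem_Iio.1 h1)) (Set.mem_Ici.1 h2))

lemma indepFun_past_future (hX : ∀ i, Measurable (X i)) (h : iIndepFun X P) {n : ℕ}
    {γ δ : Type*} [MeasurableSpace γ] [MeasurableSpace δ] {U : Ω → γ} {V : Ω → δ}
    (hU : Measurable[past X n] U) (hV : Measurable[future X n] V) : IndepFun U V P :=
  indep_of_indep_of_le_left (indep_of_indep_of_le_right (indep_past_future hX h n) hV.comap_le)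
    hU.comap_le

end

variable {X : ℕ → Ω → ℤ} {μ : Measure ℤ}

lemma measurable_walk_past (n : ℕ) : Measurable[past X n] (walk X n) := by
  have : walk X n = fun ω => ∑ i ∈ Finset.range n, X i ω := rfl
  rw [this]
  exact @Finset.measurable_sum _ _ _ _ _ _ (past X n) _ _
    fun i hi => measurable_past (Finset.mem_range.1 hi)

lemma IsIIDWithLaw.measurable_walk (h : IsIIDWithLaw X μ P) (n : ℕ) : Measurable (walk X n) :=
  (measurable_walk_past n).mono (past_le h.measurable n) le_rfl

lemma walk_succ (n : ℕ) (ω : Ω) : walk X (n + 1) ω = walk X n ω + X n ω :=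
  Finset.sum_range_succ _ _

/-- The one-step Markov property, with the weight `g` in the role of an arbitrary functional of the
past. -/
lemma lintegral_mul_walk_succ [IsProbabilityMeasure P] (h : IsIIDWithLaw X μ P) {n : ℕ}
    {g : Ω → ℝ≥0∞} (hg : Measurable[past X n] g) (f : ℤ → ℝ≥0∞) (x : ℤ) :
    ∫⁻ ω, g ω * f (x + walk X (n + 1) ω) ∂P = ∫⁻ ω, g ω * stepOp μ f (x + walk X n ω) ∂P := by
  have hU : Measurable[past X n] fun ω => (g ω, walk X n ω) :=
    hg.prodMk (measurable_walk_past n)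
  have hind := indepFun_past_future h.measurable h.indep hU (measurable_future le_rfl)
  have := lintegral_indepFun (hU.mono (past_le h.measurable n) le_rfl) (h.measurable n) hind
    (g := fun u v => u.1 * f (x + u.2 + v)) (by
      have h1 : Measurable fun z : ℤ × ℤ => f (x + z.1 + z.2) := Measurable.of_discrete
      exact (measurable_fst.fst).mul
        (h1.comp (measurable_fst.snd.prodMk measurable_snd)))
  simp only [walk_succ, ← add_assoc]
  rw [this]
  refine lintegral_congr fun ω => ?_
  rw [h.law, lintegral_const_mul _ Measurable.of_discrete]
  rfl

lemma lintegral_mul_walk_add [IsProbabilityMeasure P] (h : IsIIDWithLaw X μ P) {n : ℕ}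
    {g : Ω → ℝ≥0∞} (hg : Measurable[past X n] g) (f : ℤ → ℝ≥0∞) (x : ℤ) (l : ℕ) :
    ∫⁻ ω, g ω * f (x + walk X (n + l) ω) ∂P
      = ∫⁻ ω, g ω * (stepOp μ)^[l] f (x + walk X n ω) ∂P := by
  induction l generalizing f with
  | zero => rfl
  | succ l ih =>
    rw [← add_assoc, lintegral_mul_walk_succ h (hg.mono (past_mono (Nat.le_add_right n l)) le_rfl),
      ih, Function.iterate_succ_apply]

lemma prob_walk_mem [IsProbabilityMeasure P] (h : IsIIDWithLaw X μ P) (A : Set ℤ) (x : ℤ) (n : ℕ) :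
    P {ω | x + walk X n ω ∈ A} = (stepOp μ)^[n] (ind A) x := by
  have h1 := lintegral_mul_walk_add h (n := 0) (g := 1) measurable_const (ind A) x n
  simp only [Pi.one_apply, one_mul, zero_add, walk, Finset.range_zero, Finset.sum_empty, add_zero,
    lintegral_const, measure_univ, mul_one] at h1
  rw [← h1]
  have hm : MeasurableSet {ω | x + walk X n ω ∈ A} :=
    (h.measurable_walk n) (MeasurableSet.of_discrete (s := {z | x + z ∈ A}))
  rw [← lintegral_indicator_one hm]
  rfl

/-- The walk started from `x` is in `C` at time `n` and then makes a step in `D`. -/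
def stepEvent (X : ℕ → Ω → ℤ) (x : ℤ) (C D : Set ℤ) (n : ℕ) : Set Ω :=
  {ω | x + walk X n ω ∈ C ∧ X n ω ∈ D}

lemma measurableSet_stepEvent_past (x : ℤ) (C D : Set ℤ) (n : ℕ) :
    MeasurableSet[past X (n + 1)] (stepEvent X x C D n) := by
  have h1 := (measurable_walk_past (X := X) n).mono (past_mono (Nat.le_succ n)) le_rfl
  exact MeasurableSet.inter (h1 (MeasurableSet.of_discrete (s := {z | x + z ∈ C})))
    (measurable_past (X := X) (Nat.lt_succ_self n) (MeasurableSet.of_discrete (s := D)))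

lemma IsIIDWithLaw.measurableSet_stepEvent (h : IsIIDWithLaw X μ P) (x : ℤ) (C D : Set ℤ) (n : ℕ) :
    MeasurableSet (stepEvent X x C D n) :=
  past_le h.measurable _ _ (measurableSet_stepEvent_past x C D n)

lemma prob_inter_step_mem [IsProbabilityMeasure P] (h : IsIIDWithLaw X μ P) {n : ℕ} {G : Set Ω}
    (hG : MeasurableSet[past X n] G) (D : Set ℤ) :
    P (G ∩ X n ⁻¹' D) = P G * μ D := by
  have h1 := (Indep_iff _ _ P).1 (indep_past_future h.measurable h.indep n) G (X n ⁻¹' D) hG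
    (measurable_future le_rfl (MeasurableSet.of_discrete (s := D)))
  rw [h1, ← h.law n, Measure.map_apply (h.measurable n) MeasurableSet.of_discrete]

lemma prob_stepEvent [IsProbabilityMeasure P] (h : IsIIDWithLaw X μ P) (x : ℤ) (C D : Set ℤ)
    (n : ℕ) : P (stepEvent X x C D n) = (stepOp μ)^[n] (ind C) x * μ D := by
  rw [← prob_walk_mem h, ← prob_inter_step_mem h]
  · rfl
  · exact measurable_walk_past n (MeasurableSet.of_discrete (s := {z | x + z ∈ C}))

/-- The first event is decided at time `n + 1`, so `l` further steps are free before the second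
visit to `C`. The uniform bound `c` makes the position at time `n + 1` irrelevant. -/
lemma prob_stepEvent_inter_le [IsProbabilityMeasure P] (h : IsIIDWithLaw X μ P) (x : ℤ)
    (C D : Set ℤ) (n l : ℕ) {c : ℝ≥0∞} (hc : ∀ z, (stepOp μ)^[l] (ind C) z ≤ c) :
    P (stepEvent X x C D n ∩ stepEvent X x C D (n + 1 + l))
      ≤ P (stepEvent X x C D n) * (c * μ D) := by
  set G := stepEvent X x C D n
  have hG : MeasurableSet[past X (n + 1)] G := measurableSet_stepEvent_past x C D n
  have hG' : MeasurableSet G := past_le h.measurable _ _ hG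
  set m := n + 1 + l
  have hH : MeasurableSet[past X m] {ω | x + walk X m ω ∈ C} :=
    measurable_walk_past m (MeasurableSet.of_discrete (s := {z | x + z ∈ C}))
  have h1 : G ∩ stepEvent X x C D m = (G ∩ {ω | x + walk X m ω ∈ C}) ∩ X m ⁻¹' D := by
    ext ω; simp [stepEvent, and_assoc]
  have h2 : P (G ∩ {ω | x + walk X m ω ∈ C}) ≤ P G * c := by
    have h3 := lintegral_mul_walk_add h (g := G.indicator 1)
      ((measurable_const (a := (1 : ℝ≥0∞))).indicator hG) (ind C) x l
    have h4 : P (G ∩ {ω | x + walk X m ω ∈ C})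
        = ∫⁻ ω, G.indicator 1 ω * ind C (x + walk X m ω) ∂P := by
      rw [← lintegral_indicator_one (hG'.inter (past_le h.measurable _ _ hH))]
      refine lintegral_congr fun ω => ?_
      by_cases h5 : ω ∈ G <;> by_cases h6 : x + walk X m ω ∈ C <;>
        simp [ind, h5, h6]
    rw [h4, h3]
    calc _ ≤ ∫⁻ ω, G.indicator 1 ω * c ∂P :=
          lintegral_mono fun ω => by gcongr; exact hc _
      _ = P G * c := by
        rw [lintegral_mul_const _ (measurable_one.indicator hG'), lintegral_indicator_one hG']
  rw [h1, prob_inter_step_mem h (MeasurableSet.inter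
    (past_mono (Nat.le_add_right _ _) _ hG) hH), ← mul_assoc]
  gcongr

end Markov

/-! ### Symmetric unimodal functions -/

/-- A function on the integers that is even and nonincreasing in the absolute value. -/
def IsUnimodal (f : ℤ → ℝ≥0∞) : Prop := ∀ x y : ℤ, |x| ≤ |y| → f y ≤ f x

lemma IsUnimodal.neg {f : ℤ → ℝ≥0∞} (h : IsUnimodal f) (x : ℤ) : f (-x) = f x :=
  le_antisymm (h _ _ (abs_neg x).ge) (h _ _ (abs_neg x).le)

lemma IsUnimodal.le_zero {f : ℤ → ℝ≥0∞} (h : IsUnimodal f) (x : ℤ) : f x ≤ f 0 :=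
  h _ _ (by simp)

lemma isUnimodal_of_succ_le {f : ℤ → ℝ≥0∞} (hneg : ∀ x, f (-x) = f x)
    (hsucc : ∀ x, 0 ≤ x → f (x + 1) ≤ f x) : IsUnimodal f := by
  have habs : ∀ x, f |x| = f x := fun x => by
    rcases abs_choice x with h | h <;> rw [h]
    exact hneg x
  have hanti : ∀ x : ℤ, 0 ≤ x → ∀ n : ℕ, f (x + n) ≤ f x := fun x hx n => by
    induction n with
    | zero => simp
    | succ n ih =>
      refine le_trans ?_ ih
      have := hsucc (x + n) (by positivity)
      simpa [add_assoc] using this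
  intro x y hxy
  obtain ⟨n, hn⟩ := Int.le.dest hxy
  rw [← habs x, ← habs y, ← hn]
  exact hanti _ (abs_nonneg x) n

lemma isUnimodal_ind_zero : IsUnimodal (ind {0}) := by
  intro x y h
  by_cases hx : x = 0
  · subst hx; simpa [ind] using ind_le_one {0} y
  · have hy : y ≠ 0 := by rintro rfl; simp at h; exact hx h
    simp [ind, hy]

/-- Moving the window one unit to the right, away from the origin, trades its left end point for a
new right end point of at least the same absolute value. -/
lemma IsUnimodal.sum_window {f : ℤ → ℝ≥0∞} (h : IsUnimodal f) (a : ℕ) :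
    IsUnimodal fun x => ∑ v ∈ Finset.Icc (-a : ℤ) a, f (x + v) := by
  refine isUnimodal_of_succ_le (fun x => ?_) fun x hx => ?_
  · refine Finset.sum_bij' (fun v _ => -v) (fun v _ => -v) ?_ ?_ ?_ ?_ ?_
    · intro v hv; simp only [Finset.mem_Icc] at hv ⊢; omega
    · intro v hv; simp only [Finset.mem_Icc] at hv ⊢; omega
    · simp
    · simp
    · intro v _
      rw [← h.neg]
      congr 1; ring
  · have h1 : ∑ v ∈ Finset.Icc (-a : ℤ) a, f (x + 1 + v)
        = ∑ v ∈ Finset.Icc (-a + 1 : ℤ) (a + 1), f (x + v) := by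
      refine Finset.sum_bij' (fun v _ => v + 1) (fun v _ => v - 1) ?_ ?_ ?_ ?_ ?_
      · intro v hv; simp only [Finset.mem_Icc] at hv ⊢; omega
      · intro v hv; simp only [Finset.mem_Icc] at hv ⊢; omega
      · simp
      · simp
      · intro v _
        congr 1; ring
    have h2 : Finset.Icc (-a + 1 : ℤ) (a + 1) = insert (a + 1 : ℤ) (Finset.Icc (-a + 1 : ℤ) a) := by
      ext v; simp only [Finset.mem_Icc, Finset.mem_insert]; omega
    have h3 : Finset.Icc (-a : ℤ) a = insert (-a : ℤ) (Finset.Icc (-a + 1 : ℤ) a) := by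
      ext v; simp only [Finset.mem_Icc, Finset.mem_insert]; omega
    rw [h1, h2, h3, Finset.sum_insert (by simp), Finset.sum_insert (by simp)]
    gcongr
    apply h
    rw [abs_le]
    constructor
    · have := le_abs_self (x + (a + 1)); omega
    · have := le_abs_self (x + (a + 1)); omega

/-! ### Uniform laws and their mixtures -/

/-- The uniform law on `{-a, …, a}`. -/
noncomputable def unif (a : ℕ) : Measure ℤ :=
  (2 * a + 1 : ℝ≥0∞)⁻¹ • ∑ v ∈ Finset.Icc (-a : ℤ) a, Measure.dirac v

lemma lintegral_unif (a : ℕ) (f : ℤ → ℝ≥0∞) :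
    ∫⁻ v, f v ∂(unif a) = (2 * a + 1 : ℝ≥0∞)⁻¹ * ∑ v ∈ Finset.Icc (-a : ℤ) a, f v := by
  simp [unif, lintegral_smul_measure]

lemma card_window (a : ℕ) : ((Finset.Icc (-a : ℤ) a).card : ℝ≥0∞) = 2 * a + 1 := by
  rw [Int.card_Icc, show ((a : ℤ) + 1 - -a).toNat = 2 * a + 1 by omega]
  push_cast; rfl

lemma window_ne_zero (a : ℕ) : (2 * a + 1 : ℝ≥0∞) ≠ 0 := by simp

lemma window_ne_top (a : ℕ) : (2 * a + 1 : ℝ≥0∞) ≠ ∞ :=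
  ENNReal.add_ne_top.2 ⟨ENNReal.mul_ne_top (by simp) (by simp), by simp⟩

instance (a : ℕ) : IsProbabilityMeasure (unif a) where
  measure_univ := by
    have h := lintegral_unif a (fun _ => 1)
    rw [lintegral_one, Finset.sum_const, nsmul_eq_mul, mul_one, card_window,
      ENNReal.inv_mul_cancel (window_ne_zero a) (window_ne_top a)] at h
    exact h

lemma stepOp_unif (a : ℕ) (f : ℤ → ℝ≥0∞) (x : ℤ) :
    stepOp (unif a) f x = (2 * a + 1 : ℝ≥0∞)⁻¹ * ∑ v ∈ Finset.Icc (-a : ℤ) a, f (x + v) :=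
  lintegral_unif a _

lemma IsUnimodal.stepOp_unif {f : ℤ → ℝ≥0∞} (h : IsUnimodal f) (a : ℕ) :
    IsUnimodal (stepOp (unif a) f) := fun x y hxy => by
  rw [_root_.stepOp_unif, _root_.stepOp_unif]
  exact mul_le_mul' le_rfl (h.sum_window a x y hxy)

/-- A mixture of two uniform laws, which is the law of `V + (2 a + 1) (B - 1)` where `V` is
uniform on `{-a, …, a}` and `B` is an independent binomial variable with parameters `2`, `1/2`. -/
noncomputable def jump (a : ℕ) : Measure ℤ :=
  (1 / 4 : ℝ≥0∞) • unif a + (3 / 4 : ℝ≥0∞) • unif (3 * a + 1)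

lemma stepOp_jump (a : ℕ) (f : ℤ → ℝ≥0∞) (x : ℤ) :
    stepOp (jump a) f x
      = (1 / 4) * stepOp (unif a) f x + (3 / 4) * stepOp (unif (3 * a + 1)) f x := by
  simp [stepOp, jump, lintegral_add_measure, lintegral_smul_measure]

lemma quarter_add_three_quarters : (1 / 4 + 3 / 4 : ℝ≥0∞) = 1 := by
  rw [← ENNReal.add_div, show (1 + 3 : ℝ≥0∞) = 4 by norm_num]
  exact ENNReal.div_self (by norm_num) (by norm_num)

instance (a : ℕ) : IsProbabilityMeasure (jump a) where
  measure_univ := by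
    simp only [jump, Measure.coe_add, Pi.add_apply, Measure.smul_apply, measure_univ, smul_eq_mul,
      mul_one]
    exact quarter_add_three_quarters

lemma IsUnimodal.stepOp_jump {f : ℤ → ℝ≥0∞} (h : IsUnimodal f) (a : ℕ) :
    IsUnimodal (stepOp (jump a) f) := fun x y hxy => by
  rw [_root_.stepOp_jump, _root_.stepOp_jump]
  gcongr
  · exact h.stepOp_unif _ x y hxy
  · exact h.stepOp_unif _ x y hxy

/-! ### Anti-concentration of sums of jumps -/

/-- The two-step transition operator of a simple walk with holding probability `1/2` and
steps `±M`. -/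
noncomputable def coinOp (M : ℤ) (f : ℤ → ℝ≥0∞) (x : ℤ) : ℝ≥0∞ :=
  (1 / 4) * f (x - M) + (1 / 2) * f x + (1 / 4) * f (x + M)

lemma sum_window_three_mul (a : ℕ) (f : ℤ → ℝ≥0∞) (x : ℤ) :
    ∑ v ∈ Finset.Icc (-(3 * a + 1 : ℕ) : ℤ) (3 * a + 1 : ℕ), f (x + v)
      = ∑ v ∈ Finset.Icc (-a : ℤ) a, f (x - (2 * a + 1) + v)
        + ∑ v ∈ Finset.Icc (-a : ℤ) a, f (x + v)
        + ∑ v ∈ Finset.Icc (-a : ℤ) a, f (x + (2 * a + 1) + v) := by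
  have e1 : ∑ v ∈ Finset.Icc (-a : ℤ) a, f (x - (2 * a + 1) + v)
      = ∑ v ∈ Finset.Icc (-(3 * a + 1) : ℤ) (-a - 1), f (x + v) := by
    refine Finset.sum_bij' (fun v _ => v - (2 * a + 1)) (fun v _ => v + (2 * a + 1)) ?_ ?_ ?_ ?_ ?_
    · intro v hv; simp only [Finset.mem_Icc] at hv ⊢; omega
    · intro v hv; simp only [Finset.mem_Icc] at hv ⊢; omega
    · intros; ring
    · intros; ring
    · intro v _; congr 1; ring
  have e2 : ∑ v ∈ Finset.Icc (-a : ℤ) a, f (x + (2 * a + 1) + v)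
      = ∑ v ∈ Finset.Icc (a + 1 : ℤ) (3 * a + 1), f (x + v) := by
    refine Finset.sum_bij' (fun v _ => v + (2 * a + 1)) (fun v _ => v - (2 * a + 1)) ?_ ?_ ?_ ?_ ?_
    · intro v hv; simp only [Finset.mem_Icc] at hv ⊢; omega
    · intro v hv; simp only [Finset.mem_Icc] at hv ⊢; omega
    · intros; ring
    · intros; ring
    · intro v _; congr 1; ring
  have d1 : Disjoint (Finset.Icc (-(3 * a + 1) : ℤ) (-a - 1)) (Finset.Icc (-a : ℤ) a) := by
    rw [Finset.disjoint_left]; intro v; simp only [Finset.mem_Icc]; omega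
  have d2 : Disjoint (Finset.Icc (-(3 * a + 1) : ℤ) (-a - 1) ∪ Finset.Icc (-a : ℤ) a)
      (Finset.Icc (a + 1 : ℤ) (3 * a + 1)) := by
    rw [Finset.disjoint_left]; intro v; simp only [Finset.mem_Icc, Finset.mem_union]; omega
  rw [e1, e2, ← Finset.sum_union d1, ← Finset.sum_union d2]
  refine Finset.sum_congr ?_ fun _ _ => rfl
  ext v; simp only [Finset.mem_Icc, Finset.mem_union]; push_cast; omega

/-- The window of radius `3a + 1` is tiled by three translates of the window of radius `a`. Its
weight 3/4 gives 1/4 to each tile, and the extra 1/4 on the middle one produces the binomial weights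
1/4, 1/2, 1/4. -/
lemma stepOp_jump_eq_coinOp (a : ℕ) (f : ℤ → ℝ≥0∞) :
    stepOp (jump a) f = stepOp (unif a) (coinOp (2 * a + 1) f) := by
  funext x
  rw [stepOp_jump, stepOp_unif, stepOp_unif, stepOp_unif, sum_window_three_mul]
  simp only [coinOp, Finset.sum_add_distrib, ← Finset.mul_sum]
  have e1 : ∑ v ∈ Finset.Icc (-a : ℤ) a, f (x + v - (2 * a + 1))
      = ∑ v ∈ Finset.Icc (-a : ℤ) a, f (x - (2 * a + 1) + v) :=
    Finset.sum_congr rfl fun v _ => by congr 1; ring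
  have e2 : ∑ v ∈ Finset.Icc (-a : ℤ) a, f (x + v + (2 * a + 1))
      = ∑ v ∈ Finset.Icc (-a : ℤ) a, f (x + (2 * a + 1) + v) :=
    Finset.sum_congr rfl fun v _ => by congr 1; ring
  rw [e1, e2]
  have h3 : (3 / 4 : ℝ≥0∞) * (2 * (3 * a + 1 : ℕ) + 1 : ℝ≥0∞)⁻¹
      = 1 / 4 * (2 * a + 1 : ℝ≥0∞)⁻¹ := by
    have : (2 * (3 * a + 1 : ℕ) + 1 : ℝ≥0∞) = 3 * (2 * a + 1) := by push_cast; ring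
    rw [this, ENNReal.mul_inv (by simp) (by simp), ← mul_assoc, div_eq_mul_inv, mul_right_comm 3,
      ENNReal.mul_inv_cancel (by simp) (by simp), one_mul, one_div]
  have h2 : (1 / 2 : ℝ≥0∞) = 1 / 4 + 1 / 4 := by
    rw [← ENNReal.add_div, ENNReal.div_eq_div_iff (by simp) (by simp) (by simp) (by simp)]
    norm_num
  rw [← mul_assoc (3 / 4), h3, h2]
  ring

lemma coinOp_stepOp_comm (M : ℤ) (ν : Measure ℤ) :
    Function.Commute (coinOp M) (stepOp ν) := by
  intro f
  funext x
  simp only [coinOp, stepOp]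
  rw [lintegral_add_left Measurable.of_discrete, lintegral_add_left Measurable.of_discrete,
    lintegral_const_mul _ Measurable.of_discrete, lintegral_const_mul _ Measurable.of_discrete,
    lintegral_const_mul _ Measurable.of_discrete]
  simp only [sub_eq_add_neg, add_right_comm]

lemma stepOp_jump_iterate (a j : ℕ) (f : ℤ → ℝ≥0∞) :
    (stepOp (jump a))^[j] f = (stepOp (unif a))^[j] ((coinOp (2 * a + 1))^[j] f) := by
  have h : stepOp (jump a) = stepOp (unif a) ∘ coinOp (2 * a + 1) :=
    funext fun f => stepOp_jump_eq_coinOp a f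
  rw [h, ((coinOp_stepOp_comm (2 * a + 1) (unif a)).symm).comp_iterate]
  rfl

/-- The binomial coefficient with integer lower argument. -/
def intChoose (n : ℕ) (i : ℤ) : ℕ := if 0 ≤ i then n.choose i.toNat else 0

lemma intChoose_succ (n : ℕ) (i : ℤ) :
    intChoose (n + 1) i = intChoose n (i - 1) + intChoose n i := by
  rcases lt_trichotomy i 0 with h | rfl | h
  · simp [intChoose, not_le.2 h, show ¬ (1 ≤ i) by omega]
  · simp [intChoose]
  · obtain ⟨m, rfl⟩ : ∃ m : ℕ, i = m + 1 := ⟨(i - 1).toNat, by omega⟩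
    have h1 : ((m : ℤ) + 1).toNat = m + 1 := by omega
    simp [intChoose, h1, show (0 : ℤ) ≤ m + 1 by omega, Nat.choose_succ_succ]

lemma intChoose_two_mul_le (j : ℕ) (i : ℤ) : intChoose (2 * j) i ≤ j.centralBinom := by
  unfold intChoose
  split_ifs
  · exact Nat.choose_le_centralBinom _ _
  · exact Nat.zero_le _

/-- The window sums of the iterates of `coinOp` are binomial probabilities. -/
lemma sum_window_coinOp_iterate (a j : ℕ) (x : ℤ) :
    ∑ v ∈ Finset.Icc (-a : ℤ) a, (coinOp (2 * a + 1))^[j] (ind {0}) (x + v)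
      = intChoose (2 * j) ((x + a) / (2 * a + 1) + j) * (4 ^ j)⁻¹ := by
  induction j generalizing x with
  | zero =>
    -- A window of length `2a + 1` contains exactly one multiple of `2a + 1`, and the quotient
    -- records which one. It is zero exactly when `|x| ≤ a`.
    have h1 : ∀ v, ind {0} (x + v) = if v = -x then 1 else 0 := fun v => by
      simp [ind, Set.indicator_apply, add_eq_zero_iff_eq_neg, eq_comm (a := v), neg_eq_iff_eq_neg]
    simp only [Function.iterate_zero, id, h1, Finset.sum_ite_eq']
    by_cases hx : -(a : ℤ) ≤ x ∧ x ≤ a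
    · have : (x + a) / (2 * a + 1) = 0 := Int.ediv_eq_zero_of_lt (by omega) (by omega)
      simp [this, intChoose, Finset.mem_Icc, hx.2, neg_le.1 hx.1]
    · have h2 : ¬ (-x ∈ Finset.Icc (-a : ℤ) a) := by rw [Finset.mem_Icc]; omega
      have h3 : (x + a) / (2 * a + 1) ≠ 0 := by
        intro h
        have h4 := Int.emod_add_mul_ediv (x + a) (2 * a + 1)
        have h5 := Int.emod_nonneg (x + a) (show (2 * a + 1 : ℤ) ≠ 0 by omega)
        have h6 := Int.emod_lt_of_pos (x + a) (show (0 : ℤ) < 2 * a + 1 by omega)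
        rw [h] at h4
        omega
      have h7 : intChoose 0 ((x + a) / (2 * a + 1)) = 0 := by
        unfold intChoose
        split_ifs with h
        · exact Nat.choose_eq_zero_of_lt (by omega)
        · rfl
      simp [h2, h7]
  | succ j ih =>
    have hM : (2 * a + 1 : ℤ) ≠ 0 := by omega
    have e1 : ∀ v, x + v - (2 * a + 1) = x - (2 * a + 1) + v := fun v => by ring
    have e2 : ∀ v, x + v + (2 * a + 1) = x + (2 * a + 1) + v := fun v => by ring
    simp only [Function.iterate_succ_apply', coinOp, Finset.sum_add_distrib, ← Finset.mul_sum,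
      e1, e2, ih]
    have f1 : (x - (2 * a + 1) + a) / (2 * a + 1) = (x + a) / (2 * a + 1) - 1 := by
      rw [show x - (2 * a + 1) + a = x + a + (-1) * (2 * a + 1) by ring,
        Int.add_mul_ediv_right _ _ hM]; ring
    have f2 : (x + (2 * a + 1) + a) / (2 * a + 1) = (x + a) / (2 * a + 1) + 1 := by
      rw [show x + (2 * a + 1) + a = x + a + 1 * (2 * a + 1) by ring,
        Int.add_mul_ediv_right _ _ hM]
    rw [f1, f2]
    generalize (x + a) / (2 * a + 1) = q
    -- Pascal's rule applied twice, matching the coefficients 1, 2, 1 of `coinOp`.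
    have h1 : intChoose (2 * (j + 1)) (q + (j + 1 : ℕ))
        = intChoose (2 * j) (q - 1 + j) + 2 * intChoose (2 * j) (q + j)
          + intChoose (2 * j) (q + 1 + j) := by
      rw [show 2 * (j + 1) = 2 * j + 1 + 1 by ring, intChoose_succ, intChoose_succ, intChoose_succ]
      push_cast
      rw [show q + (j + 1) - 1 - 1 = q - 1 + (j : ℤ) by ring,
        show q + (j + 1) - 1 = q + (j : ℤ) by ring, show q + (j + 1) = q + 1 + (j : ℤ) by ring]
      ring
    have h2 : (1 / 2 : ℝ≥0∞) = 4⁻¹ * 2 := by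
      rw [show (4 : ℝ≥0∞) = 2 * 2 by norm_num, ENNReal.mul_inv (by simp) (by simp), mul_assoc,
        ENNReal.inv_mul_cancel (by simp) (by simp), one_div, mul_one]
    have h4 : ((4 : ℝ≥0∞) ^ (j + 1))⁻¹ = 4⁻¹ * (4 ^ j)⁻¹ := by
      rw [pow_succ, ENNReal.mul_inv (by simp) (by simp), mul_comm]
    rw [h1, h2, h4, one_div]
    push_cast
    ring

lemma centralBinom_sq_mul_le (j : ℕ) : j.centralBinom ^ 2 * (j + 1) ≤ 16 ^ j := by
  induction j with
  | zero => simp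
  | succ j ih =>
    have h := Nat.succ_mul_centralBinom_succ j
    have h1 : (j + 1) ^ 2 * ((j + 1).centralBinom ^ 2 * (j + 1 + 1))
        ≤ (j + 1) ^ 2 * 16 ^ (j + 1) := by
      calc (j + 1) ^ 2 * ((j + 1).centralBinom ^ 2 * (j + 1 + 1))
          = ((j + 1) * (j + 1).centralBinom) ^ 2 * (j + 2) := by ring
        _ = (4 * (2 * j + 1) ^ 2 * (j + 2)) * j.centralBinom ^ 2 := by rw [h]; ring
        _ ≤ (16 * (j + 1) ^ 3) * j.centralBinom ^ 2 := by
          gcongr ?_ * _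
          nlinarith [Nat.zero_le j]
        _ = 16 * (j + 1) ^ 2 * (j.centralBinom ^ 2 * (j + 1)) := by ring
        _ ≤ 16 * (j + 1) ^ 2 * 16 ^ j := by gcongr
        _ = _ := by ring
    exact Nat.le_of_mul_le_mul_left h1 (by positivity)

lemma centralBinom_div_le (j : ℕ) : (j.centralBinom : ℝ) / 4 ^ j ≤ 1 / √(j + 1) := by
  have h : (j.centralBinom : ℝ) ^ 2 * (j + 1) ≤ 16 ^ j := by exact_mod_cast centralBinom_sq_mul_le j
  have hs : (0 : ℝ) < √(j + 1) := Real.sqrt_pos.2 (by positivity)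
  rw [div_le_div_iff₀ (by positivity) hs, one_mul]
  refine (pow_le_pow_iff_left₀ (by positivity) (by positivity) two_ne_zero).1 ?_
  rw [mul_pow, Real.sq_sqrt (by positivity), ← pow_mul, mul_comm j 2, pow_mul]
  norm_num
  exact h

/-- Sums of at least one jump charge every point with small probability. -/
lemma hit_jump_le (a j : ℕ) (hj : j ≠ 0) (x : ℤ) :
    hit (jump a) j x ≤ ENNReal.ofReal (1 / (2 * a + 1) * (1 / √(j + 1))) := by
  obtain ⟨j, rfl⟩ := Nat.exists_eq_succ_of_ne_zero hj
  -- One of the uniform smoothings suffices: it produces the window sum and the factor `1/(2a + 1)`.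
  -- The others do not increase the supremum.
  rw [hit, stepOp_jump_iterate, Function.iterate_succ_apply]
  refine stepOp_iterate_le_of_le _ (fun y => ?_) j x
  rw [stepOp_unif, sum_window_coinOp_iterate]
  have h1 : (1 : ℝ) / (2 * a + 1) * (((j + 1).centralBinom : ℝ) / 4 ^ (j + 1))
      ≤ 1 / (2 * a + 1) * (1 / √((j + 1 : ℕ) + 1)) :=
    mul_le_mul_of_nonneg_left (centralBinom_div_le (j + 1)) (by positivity)
  refine le_trans ?_ (ENNReal.ofReal_le_ofReal h1)
  rw [ENNReal.ofReal_mul (by positivity), ENNReal.ofReal_div_of_pos (by positivity),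
    ENNReal.ofReal_div_of_pos (by positivity), ENNReal.ofReal_natCast, ENNReal.ofReal_one,
    ENNReal.ofReal_pow (by norm_num), one_div, div_eq_mul_inv]
  have h2 : ENNReal.ofReal (2 * a + 1) = 2 * a + 1 := by
    rw [ENNReal.ofReal_add (by positivity) (by norm_num), ENNReal.ofReal_mul (by norm_num)]
    simp
  rw [h2, show ENNReal.ofReal 4 = 4 by simp]
  gcongr
  exact_mod_cast intChoose_two_mul_le _ _

/-! ### Binomial averages -/

/-- The expectation of `u (K + j)` where `K` is binomial with parameters `n` and `p`. -/
def binomMean (p : ℝ) (u : ℕ → ℝ) : ℕ → ℕ → ℝ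
  | 0, j => u j
  | n + 1, j => (1 - p) * binomMean p u n j + p * binomMean p u n (j + 1)

lemma binomMean_mono {p : ℝ} (h0 : 0 ≤ p) (h1 : p ≤ 1) {u v : ℕ → ℝ} (h : ∀ i, u i ≤ v i)
    (n j : ℕ) : binomMean p u n j ≤ binomMean p v n j := by
  induction n generalizing j with
  | zero => exact h j
  | succ n ih =>
    have := sub_nonneg.2 h1
    simp only [binomMean]
    gcongr
    · exact ih j
    · exact ih (j + 1)

lemma binomMean_linear (p a b : ℝ) (u v : ℕ → ℝ) (n j : ℕ) :
    binomMean p (fun i => a * u i + b * v i) n j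
      = a * binomMean p u n j + b * binomMean p v n j := by
  induction n generalizing j with
  | zero => rfl
  | succ n ih => simp only [binomMean, ih]; ring

lemma binomMean_one (p : ℝ) (n j : ℕ) : binomMean p (fun _ => 1) n j = 1 := by
  induction n generalizing j with
  | zero => rfl
  | succ n ih => simp only [binomMean, ih]; ring

lemma binomMean_nonneg {p : ℝ} (h0 : 0 ≤ p) (h1 : p ≤ 1) {u : ℕ → ℝ} (h : ∀ i, 0 ≤ u i)
    (n j : ℕ) : 0 ≤ binomMean p u n j := by
  induction n generalizing j with
  | zero => exact h j
  | succ n ih =>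
    have := sub_nonneg.2 h1
    exact add_nonneg (mul_nonneg this (ih j)) (mul_nonneg h0 (ih (j + 1)))

lemma binomMean_shift (p : ℝ) (u : ℕ → ℝ) (n j : ℕ) :
    binomMean p u n (j + 1) = binomMean p (fun i => u (i + 1)) n j := by
  induction n generalizing j with
  | zero => rfl
  | succ n ih => simp only [binomMean, ih]

lemma binomMean_ite_zero (p : ℝ) (n : ℕ) :
    binomMean p (fun i => if i = 0 then 1 else 0) n 0 = (1 - p) ^ n := by
  have h : ∀ n j, binomMean p (fun i => if i = 0 then 1 else 0) n (j + 1) = 0 := by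
    intro n
    induction n with
    | zero => intro j; simp [binomMean]
    | succ n ih => intro j; simp [binomMean, ih]
  induction n with
  | zero => simp [binomMean]
  | succ n ih => simp only [binomMean, ih, h]; ring

/-- Size biasing of the binomial law: weighting by the number of successes amounts to forcing one
success and drawing the other `n` trials afresh. -/
lemma binomMean_mul_self (p : ℝ) (g : ℕ → ℝ) (n j : ℕ) :
    binomMean p (fun i => i * g i) (n + 1) j
      = j * binomMean p g (n + 1) j + (n + 1) * p * binomMean p g n (j + 1) := by
  induction n generalizing j with
  | zero => simp only [binomMean]; push_cast; ring
  | succ n ih =>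
    rw [binomMean, ih, ih, binomMean.eq_2 p g j (n + 1), binomMean.eq_2 p g (j + 1) n]
    push_cast; ring

lemma binomMean_inv_le {p : ℝ} (h0 : 0 < p) (h1 : p ≤ 1) (n : ℕ) :
    binomMean p (fun i => 1 / ((i : ℝ) + 1)) n 0 ≤ 1 / ((n + 1) * p) := by
  have h := binomMean_mul_self p (fun i => 1 / (i : ℝ)) n 0
  rw [Nat.cast_zero, zero_mul, zero_add, binomMean_shift] at h
  -- At `i = 0` the product is zero by the convention for division, so the inequality holds there
  -- too.
  have h2 : binomMean p (fun i => i * (1 / (i : ℝ))) (n + 1) 0 ≤ 1 := by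
    refine (binomMean_mono h0.le h1 (fun i => ?_) _ _).trans_eq (binomMean_one p (n + 1) 0)
    rw [mul_one_div]
    exact div_self_le_one _
  rw [h] at h2
  rw [le_div_iff₀ (by positivity), mul_comm]
  exact_mod_cast h2

lemma binomMean_inv_sqrt_le {p : ℝ} (h0 : 0 < p) (h1 : p ≤ 1) (n : ℕ) :
    binomMean p (fun i => 1 / √((i : ℝ) + 1)) n 0 ≤ 1 / √((n + 1) * p) := by
  set s := √((n + 1) * p) with hs
  have hs0 : 0 < s := Real.sqrt_pos.2 (by positivity)
  have hs2 : s ^ 2 = (n + 1) * p := Real.sq_sqrt (by positivity)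
  -- The inequality `1/r ≤ 1/(2s) + s/(2r^2)`, tangent at `r = s`, replaces Jensen's inequality and
  -- reduces the claim to the mean of `1/(i + 1)`.
  have h2 : binomMean p (fun i => 1 / √((i : ℝ) + 1)) n 0
      ≤ binomMean p (fun i => (1 / (2 * s)) * 1 + (s / 2) * (1 / ((i : ℝ) + 1))) n 0 := by
    refine binomMean_mono h0.le h1 (fun i => ?_) _ _
    have hi : (0 : ℝ) < √((i : ℝ) + 1) := Real.sqrt_pos.2 (by positivity)
    have hi2 : √((i : ℝ) + 1) ^ 2 = i + 1 := Real.sq_sqrt (by positivity)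
    have hi3 : 1 / ((i : ℝ) + 1) = 1 / √((i : ℝ) + 1) ^ 2 := by rw [hi2]
    rw [hi3]
    set r := √((i : ℝ) + 1)
    have : 1 / (2 * s) * 1 + s / 2 * (1 / r ^ 2) - 1 / r = (r - s) ^ 2 / (2 * s * r ^ 2) := by
      field_simp; ring
    have h3 : 0 ≤ (r - s) ^ 2 / (2 * s * r ^ 2) := by positivity
    linarith
  rw [binomMean_linear, binomMean_one] at h2
  have h3 := binomMean_inv_le h0 h1 n
  rw [← hs2] at h3
  calc _ ≤ _ := h2
    _ ≤ 1 / (2 * s) * 1 + s / 2 * (1 / s ^ 2) := by gcongr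
    _ = 1 / s := by field_simp; norm_num

/-! ### Mixtures of jumps -/

/-- The mixture of the laws `jump (a k)` with weights `w k`. -/
noncomputable def mixture (w : ℕ → ℝ≥0∞) (a : ℕ → ℕ) : Measure ℤ :=
  Measure.sum fun k => w k • jump (a k)

lemma stepOp_mixture (w : ℕ → ℝ≥0∞) (a : ℕ → ℕ) (f : ℤ → ℝ≥0∞) (x : ℤ) :
    stepOp (mixture w a) f x = ∑' k, w k * stepOp (jump (a k)) f x := by
  simp [stepOp, mixture, lintegral_sum_measure, lintegral_smul_measure]

lemma mixture_apply (w : ℕ → ℝ≥0∞) (a : ℕ → ℕ) (A : Set ℤ) :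
    mixture w a A = ∑' k, w k * jump (a k) A := by
  rw [mixture, Measure.sum_apply _ MeasurableSet.of_discrete]
  rfl

lemma isProbabilityMeasure_mixture {w : ℕ → ℝ≥0∞} (a : ℕ → ℕ) (hw : ∑' k, w k = 1) :
    IsProbabilityMeasure (mixture w a) :=
  ⟨by simp [mixture_apply, hw]⟩

lemma IsUnimodal.stepOp_mixture {f : ℤ → ℝ≥0∞} (h : IsUnimodal f) (w : ℕ → ℝ≥0∞) (a : ℕ → ℕ) :
    IsUnimodal (stepOp (mixture w a) f) := fun x y hxy => by
  rw [_root_.stepOp_mixture, _root_.stepOp_mixture]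
  exact ENNReal.tsum_le_tsum fun k => mul_le_mul' le_rfl (h.stepOp_jump (a k) x y hxy)

lemma isUnimodal_hit_mixture (w : ℕ → ℝ≥0∞) (a : ℕ → ℕ) (n : ℕ) :
    IsUnimodal (hit (mixture w a) n) := by
  induction n with
  | zero => exact isUnimodal_ind_zero
  | succ n ih => rw [hit_succ]; exact ih.stepOp_mixture w a

lemma mixture_isNegInvariant (w : ℕ → ℝ≥0∞) (a : ℕ → ℕ) : (mixture w a).IsNegInvariant := by
  constructor
  ext A hA
  have hm : Measurable (fun x : ℤ => -x) := Measurable.of_discrete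
  rw [Measure.neg_def, Measure.map_apply hm hA]
  have hsing : ∀ A : Set ℤ, mixture w a A = ∑' z : ℤ, A.indicator (fun z => mixture w a {z}) z :=
    fun A => (Measure.tsum_indicator_apply_singleton _ A MeasurableSet.of_discrete).symm
  have hz : ∀ z : ℤ, mixture w a {-z} = mixture w a {z} := fun z => by
    -- Point masses are one-step hitting probabilities, which are even by unimodality.
    have h1 : ∀ y : ℤ, mixture w a {y} = hit (mixture w a) 1 (-y) := fun y => by
      simp only [hit, Function.iterate_one, stepOp]
      rw [← lintegral_indicator_one (MeasurableSet.singleton y)]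
      refine lintegral_congr fun v => ?_
      simp only [ind, Set.indicator_apply, Set.mem_singleton_iff, neg_add_eq_zero, eq_comm,
        Pi.one_apply]
    rw [h1, h1, (isUnimodal_hit_mixture w a 1).neg]
  rw [hsing, hsing, ← (Equiv.neg ℤ).tsum_eq]
  refine tsum_congr fun z => ?_
  by_cases h : z ∈ A <;> simp [h, hz]

/-- Averaging preserves a supremum bound, so the components other than `k` can be lumped together
with their total weight. Only component `k` is kept exactly. -/
lemma stepOp_mixture_le {w : ℕ → ℝ≥0∞} (a : ℕ → ℕ) (hw : ∑' k, w k = 1) (k : ℕ)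
    {f : ℤ → ℝ≥0∞} {c : ℝ} (h : ∀ x, f x ≤ ENNReal.ofReal c) (x : ℤ) :
    stepOp (mixture w a) f x ≤ ENNReal.ofReal (1 - (w k).toReal) * ENNReal.ofReal c
      + w k * stepOp (jump (a k)) f x := by
  rw [stepOp_mixture, ENNReal.tsum_eq_add_tsum_ite k, add_comm]
  gcongr
  rw [ENNReal.tsum_eq_add_tsum_ite k] at hw
  have hne : w k ≠ ∞ := fun h => by simp [h] at hw
  have h1 : (∑' i, if i = k then 0 else w i) = ENNReal.ofReal (1 - (w k).toReal) := by
    rw [ENNReal.ofReal_sub _ ENNReal.toReal_nonneg, ENNReal.ofReal_toReal hne, ENNReal.ofReal_one,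
      ← hw, ENNReal.add_sub_cancel_left hne]
    exact tsum_congr fun i => by by_cases hi : i = k <;> simp [hi]
  rw [← h1, ← ENNReal.tsum_mul_right]
  refine ENNReal.tsum_le_tsum fun i => ?_
  by_cases hi : i = k
  · simp [hi]
  · simp only [hi, if_false]
    gcongr
    simpa using stepOp_le_of_le (jump (a i)) h x

/-- Local upper bound for a walk with jumps at scale `a k` at rate `w k`. -/
lemma hit_mixture_le {w : ℕ → ℝ≥0∞} (a : ℕ → ℕ) (hw : ∑' k, w k = 1) (k : ℕ) (hk : w k ≠ 0)
    (n : ℕ) (x : ℤ) :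
    hit (mixture w a) n x ≤ ENNReal.ofReal ((1 - (w k).toReal) ^ n
      + 1 / (2 * a k + 1) * (1 / √((n + 1) * (w k).toReal))) := by
  have : IsProbabilityMeasure (mixture w a) := isProbabilityMeasure_mixture a hw
  have hle : w k ≤ 1 := hw ▸ ENNReal.le_tsum k
  have hne : w k ≠ ∞ := ne_top_of_le_ne_top ENNReal.one_ne_top hle
  set p := (w k).toReal with hp
  have hwp : w k = ENNReal.ofReal p := (ENNReal.ofReal_toReal hne).symm
  have hp0 : 0 < p := ENNReal.toReal_pos hk hne
  have hp1 : p ≤ 1 := by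
    rw [hp, ← ENNReal.toReal_one]; exact ENNReal.toReal_mono ENNReal.one_ne_top hle
  set u : ℕ → ℝ := fun j => if j = 0 then 1 else 1 / (2 * a k + 1) * (1 / √((j : ℝ) + 1)) with hu
  have hu0 : ∀ j, 0 ≤ u j := fun j => by simp only [hu]; split_ifs <;> positivity
  -- Here `j` counts the jumps of scale `k` already set aside. Each step adds one with probability
  -- `p`, so their number is binomial. With no such jump there is no smoothing, whence the value 1
  -- of `u` at 0.
  have key : ∀ n j x, (stepOp (mixture w a))^[n] (hit (jump (a k)) j) x
      ≤ ENNReal.ofReal (binomMean p u n j) := by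
    intro n
    induction n with
    | zero =>
      intro j x
      simp only [Function.iterate_zero, id, binomMean, hu]
      split_ifs with hj
      · simpa using hit_le_one _ _ _
      · exact hit_jump_le _ _ hj _
    | succ n ih =>
      intro j x
      rw [Function.iterate_succ_apply']
      refine (stepOp_mixture_le a hw k (ih j) x).trans ?_
      have hcomm : stepOp (jump (a k)) ((stepOp (mixture w a))^[n] (hit (jump (a k)) j))
          = (stepOp (mixture w a))^[n] (hit (jump (a k)) (j + 1)) := by
        rw [hit_succ]
        exact (stepOp_comm _ _).iterate_right n _
      rw [hcomm, binomMean, ENNReal.ofReal_add (mul_nonneg (sub_nonneg.2 hp1)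
        (binomMean_nonneg hp0.le hp1 hu0 _ _)) (mul_nonneg hp0.le
        (binomMean_nonneg hp0.le hp1 hu0 _ _)), ENNReal.ofReal_mul (sub_nonneg.2 hp1),
        ENNReal.ofReal_mul hp0.le]
      exact add_le_add le_rfl (mul_le_mul' hwp.le (ih (j + 1) x))
  refine (key n 0 x).trans (ENNReal.ofReal_le_ofReal ?_)
  have h1 : binomMean p u n 0 ≤ binomMean p (fun i => 1 * (if i = 0 then 1 else 0)
      + 1 / (2 * a k + 1) * (1 / √((i : ℝ) + 1))) n 0 := by
    refine binomMean_mono hp0.le hp1 (fun i => ?_) _ _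
    simp only [hu]
    split_ifs
    · have : (0 : ℝ) ≤ 1 / (2 * a k + 1) * (1 / √((i : ℝ) + 1)) := by positivity
      linarith
    · simp
  rw [binomMean_linear, binomMean_ite_zero, one_mul] at h1
  refine h1.trans ?_
  gcongr
  exact binomMean_inv_sqrt_le hp0 hp1 n

/-! ### The step law -/

/-- The rapidly growing sequence of time scales. -/
def scale : ℕ → ℕ
  | 0 => 1
  -- The second moment argument samples `2 ^ (scale k ^ 8)` times with spacing `scale k ^ 2`. The
  -- factor 4 puts the last of them at a quarter of the next scale.
  | k + 1 => 4 * scale k ^ 2 * 2 ^ (scale k ^ 8)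

lemma one_le_scale (k : ℕ) : 1 ≤ scale k := by
  induction k with
  | zero => exact le_rfl
  | succ k ih =>
    have : 0 < scale k := ih
    exact Nat.one_le_iff_ne_zero.2 (by simp only [scale]; positivity)

lemma one_le_scale_real (k : ℕ) : (1 : ℝ) ≤ scale k := by exact_mod_cast one_le_scale k

lemma two_mul_scale_le (k : ℕ) : 2 * scale k ≤ scale (k + 1) := by
  have h := one_le_scale k
  have h2 : 1 ≤ 2 ^ (scale k ^ 8) := Nat.one_le_two_pow
  calc 2 * scale k ≤ 4 * (scale k * scale k) * 1 := by nlinarith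
    _ ≤ 4 * (scale k * scale k) * 2 ^ (scale k ^ 8) := by gcongr
    _ = scale (k + 1) := by rw [scale]; ring

lemma two_mul_scale_le_real (k : ℕ) : 2 * (scale k : ℝ) ≤ scale (k + 1) := by
  exact_mod_cast two_mul_scale_le k

lemma two_pow_le_scale (k : ℕ) : 2 ^ k ≤ scale k := by
  induction k with
  | zero => exact le_rfl
  | succ k ih =>
    have := two_mul_scale_le k
    rw [pow_succ]; omega

lemma scale_mono : Monotone scale :=
  monotone_nat_of_le_succ fun k => by have := two_mul_scale_le k; omega

lemma tendsto_scale : Tendsto scale atTop atTop :=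
  tendsto_atTop_mono (fun k => (Nat.lt_two_pow_self (n := k)).le.trans (two_pow_le_scale k))
    tendsto_id

/-- The rate of the jumps at scale `k`. -/
noncomputable def rate (k : ℕ) : ℝ := 1 / scale k - 1 / scale (k + 1)

lemma rate_le (k : ℕ) : rate k ≤ 1 / scale k := by
  have : (0 : ℝ) ≤ 1 / scale (k + 1) := by positivity
  unfold rate; linarith

lemma le_rate (k : ℕ) : 1 / (2 * (scale k : ℝ)) ≤ rate k := by
  have h := one_le_scale_real k
  have : (1 : ℝ) / scale (k + 1) ≤ 1 / (2 * (scale k : ℝ)) :=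
    one_div_le_one_div_of_le (by positivity) (two_mul_scale_le_real k)
  have h2 : (1 : ℝ) / scale k = 1 / (2 * (scale k : ℝ)) + 1 / (2 * (scale k : ℝ)) := by
    field_simp; norm_num
  unfold rate; linarith

lemma rate_pos (k : ℕ) : 0 < rate k :=
  lt_of_lt_of_le (by have := one_le_scale_real k; positivity) (le_rate k)

lemma sum_rate (n : ℕ) : ∑ k ∈ Finset.range n, rate k = 1 - 1 / scale n := by
  unfold rate
  rw [Finset.sum_range_sub' (fun k => (1 : ℝ) / scale k)]
  simp [scale]

/-- The weights of the step law. -/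
noncomputable def weight (k : ℕ) : ℝ≥0∞ := ENNReal.ofReal (rate k)

lemma toReal_weight (k : ℕ) : (weight k).toReal = rate k :=
  ENNReal.toReal_ofReal (rate_pos k).le

lemma hasSum_rate : HasSum rate 1 := by
  rw [hasSum_iff_tendsto_nat_of_nonneg fun k => (rate_pos k).le]
  simp only [sum_rate]
  have h : Tendsto (fun n => (1 : ℝ) / scale n) atTop (nhds 0) :=
    (tendsto_one_div_atTop_nhds_zero_nat (𝕜 := ℝ)).comp tendsto_scale
  simpa using h.const_sub 1

lemma tsum_weight : ∑' k, weight k = 1 := by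
  unfold weight
  rw [← ENNReal.ofReal_tsum_of_nonneg (fun k => (rate_pos k).le) hasSum_rate.summable,
    hasSum_rate.tsum_eq, ENNReal.ofReal_one]

/-- The radius of the jumps at scale `k`. -/
def radius (k : ℕ) : ℕ := scale k ^ 5

/-- The step law of the random walk. -/
noncomputable def stepLaw : Measure ℤ := mixture weight radius

instance : IsProbabilityMeasure stepLaw := isProbabilityMeasure_mixture _ tsum_weight

lemma isUnimodal_hit (n : ℕ) : IsUnimodal (hit stepLaw n) := isUnimodal_hit_mixture _ _ n

/-! ### Upper bounds on the return probabilities -/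

/-- The constant in the local upper bound. -/
def upperConst : ℝ := 138241

/-- With `r = √(n + 1) ≥ d`, the exponent has size at least `r/2`, and `√((n + 1) d^9) ≤ r^6`. The
sixth Taylor term of the exponential therefore suffices, and `46080 = 2^6 * 6!`. -/
lemma exp_neg_rate_le {k n : ℕ} (h : scale k ^ 2 ≤ n + 1) :
    Real.exp (-((n + 1) * rate k)) ≤ 46080 / √((n + 1) * (scale k : ℝ) ^ 9) := by
  have hd := one_le_scale_real k
  set d : ℝ := (scale k : ℝ) with hd'
  have hN : d ^ 2 ≤ (n : ℝ) + 1 := by rw [hd']; exact_mod_cast h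
  set N : ℝ := (n : ℝ) + 1 with hN'
  have hN0 : 0 < N := by positivity
  set r := √N with hr
  have hr2 : r ^ 2 = N := Real.sq_sqrt hN0.le
  have hr0 : 0 < r := Real.sqrt_pos.2 hN0
  have hdr : d ≤ r := Real.le_sqrt_of_sq_le hN
  have h1 : r / 2 ≤ N * rate k := by
    calc r / 2 ≤ N * (1 / (2 * d)) := by
          rw [mul_one_div, div_le_div_iff₀ (by positivity) (by positivity), ← hr2]
          nlinarith
      _ ≤ N * rate k := by gcongr; exact le_rate k
  have h2 : √(N * d ^ 9) ≤ r ^ 6 := by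
    rw [Real.sqrt_le_left (by positivity), ← hr2]
    calc r ^ 2 * d ^ 9 ≤ r ^ 2 * d ^ 10 := by gcongr; norm_num
      _ ≤ r ^ 2 * r ^ 10 := by gcongr
      _ = (r ^ 6) ^ 2 := by ring
  have h3 := Real.pow_div_factorial_le_exp (r / 2) (by positivity) 6
  have h4 : r ^ 6 / 46080 ≤ Real.exp (N * rate k) := by
    calc r ^ 6 / 46080 = (r / 2) ^ 6 / (Nat.factorial 6 : ℕ) := by
          norm_num [Nat.factorial]; ring
      _ ≤ _ := h3
      _ ≤ _ := Real.exp_le_exp.2 h1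
  have h5 : 0 < √(N * d ^ 9) := Real.sqrt_pos.2 (by positivity)
  rw [Real.exp_neg, inv_eq_one_div, div_le_div_iff₀ (Real.exp_pos _) h5]
  rw [div_le_iff₀ (by norm_num)] at h4
  linarith

lemma hit_le {k n : ℕ} (h : scale k ^ 2 ≤ n + 1) (x : ℤ) :
    hit stepLaw n x ≤ ENNReal.ofReal (upperConst / √((n + 1) * (scale k : ℝ) ^ 9)) := by
  have hk : weight k ≠ 0 := by simp [weight, rate_pos k]
  refine (hit_mixture_le radius tsum_weight k hk n x).trans (ENNReal.ofReal_le_ofReal ?_)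
  rw [toReal_weight]
  have hd := one_le_scale_real k
  have hp0 := rate_pos k
  have hp1 : rate k ≤ 1 := (rate_le k).trans (by rw [div_le_one (by positivity)]; exact hd)
  have hw := le_rate k
  have h1 := exp_neg_rate_le h
  set d : ℝ := (scale k : ℝ) with hd'
  set N : ℝ := (n : ℝ) + 1 with hN'
  have hN0 : 0 < N := by positivity
  have h5 : 0 < √(N * d ^ 9) := Real.sqrt_pos.2 (by positivity)
  -- The case without any jump of scale `k`. Replacing `n` by `n + 1` in the exponent costs at most
  -- `e ≤ 3`. Together with the constant 1 of `h3` this gives `upperConst = 3 * 46080 + 1`.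
  have h2 : (1 - rate k) ^ n ≤ 3 * (46080 / √(N * d ^ 9)) := by
    calc (1 - rate k) ^ n ≤ Real.exp (-rate k) ^ n := by
          refine pow_le_pow_left₀ (by linarith) ?_ n
          have := Real.add_one_le_exp (-rate k); linarith
      _ = Real.exp (rate k) * Real.exp (-(N * rate k)) := by
          rw [← Real.exp_nat_mul, ← Real.exp_add]; congr 1; rw [hN']; ring
      _ ≤ 3 * (46080 / √(N * d ^ 9)) := by
          gcongr
          calc Real.exp (rate k) ≤ Real.exp 1 := Real.exp_le_exp.2 hp1
            _ ≤ 3 := by have := Real.exp_one_lt_d9; linarith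
  have h3 : 1 / (2 * (radius k : ℝ) + 1) * (1 / √(N * rate k)) ≤ 1 / √(N * d ^ 9) := by
    rw [div_mul_div_comm, one_mul]
    refine one_div_le_one_div_of_le h5 ?_
    have hr : (radius k : ℝ) = d ^ 5 := by simp [radius, hd']
    calc √(N * d ^ 9) ≤ √((2 * d ^ 5) ^ 2 * (N * rate k)) := by
          apply Real.sqrt_le_sqrt
          have : (2 * d ^ 5) ^ 2 * (N * (1 / (2 * d))) = 2 * (N * d ^ 9) := by field_simp
          have h6 : (2 * d ^ 5) ^ 2 * (N * (1 / (2 * d))) ≤ (2 * d ^ 5) ^ 2 * (N * rate k) := by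
            gcongr
          have : 0 ≤ N * d ^ 9 := by positivity
          linarith
      _ = 2 * d ^ 5 * √(N * rate k) := by
          rw [Real.sqrt_mul (by positivity), Real.sqrt_sq (by positivity)]
      _ ≤ _ := by rw [hr]; gcongr; exact (lt_add_one _).le
  calc _ ≤ 3 * (46080 / √(N * d ^ 9)) + 1 / √(N * d ^ 9) := add_le_add h2 h3
    _ = upperConst / √(N * d ^ 9) := by unfold upperConst; ring

lemma log_scale_succ_le (k : ℕ) : Real.log (scale (k + 1)) ≤ 5 * (scale k : ℝ) ^ 8 := by
  have hd := one_le_scale_real k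
  have h0 : (0 : ℝ) < scale k := by linarith
  have e : (scale (k + 1) : ℝ) = 4 * (scale k : ℝ) ^ 2 * 2 ^ (scale k ^ 8) := by
    simp [scale]
  rw [e, Real.log_mul (by positivity) (by positivity), Real.log_mul (by positivity) (by positivity),
    Real.log_pow, Real.log_pow, show (4 : ℝ) = 2 ^ 2 by norm_num, Real.log_pow]
  push_cast
  set d : ℝ := (scale k : ℝ)
  have h1 : Real.log 2 ≤ 1 := by have := Real.log_two_lt_d9; linarith
  have h2 : Real.log d ≤ d - 1 := Real.log_le_sub_one_of_pos h0
  have h3 : d ≤ d ^ 8 := le_self_pow₀ hd (by norm_num)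
  have h4 : d ^ 8 * Real.log 2 ≤ d ^ 8 * 1 := by gcongr
  linarith

lemma sum_one_div_le_log (n : ℕ) :
    ∑ i ∈ Finset.range n, (1 : ℝ) / (i + 1) ≤ 1 + Real.log n := by
  have := harmonic_le_one_add_log n
  simp only [harmonic, Rat.cast_sum, Rat.cast_inv, Rat.cast_natCast] at this
  simpa using this

lemma log_le_sum_one_div (n : ℕ) :
    Real.log (n + 1) ≤ ∑ i ∈ Finset.range n, (1 : ℝ) / (i + 1) := by
  have := log_add_one_le_harmonic n
  simp only [harmonic, Rat.cast_sum, Rat.cast_inv, Rat.cast_natCast] at this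
  simpa using this

/-- The harmonic sum up to the next scale squared is at most `11 d^8`, while the squared local bound
carries `1/d^9`. What remains is `1/d ≤ 2^(-k)`. -/
lemma sum_hit_sq_window_le (k : ℕ) :
    ∑ n ∈ Finset.Ico (scale k ^ 2 - 1) (scale (k + 1) ^ 2 - 1), hit stepLaw n 0 ^ 2
      ≤ ENNReal.ofReal (11 * upperConst ^ 2 * (1 / 2) ^ k) := by
  have hd := one_le_scale_real k
  have h0 : (0 : ℝ) < scale k := by linarith
  have h1 : ∀ n ∈ Finset.Ico (scale k ^ 2 - 1) (scale (k + 1) ^ 2 - 1),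
      hit stepLaw n 0 ^ 2
        ≤ ENNReal.ofReal (upperConst ^ 2 / (scale k : ℝ) ^ 9 * (1 / ((n : ℝ) + 1))) := by
    intro n hn
    rw [Finset.mem_Ico] at hn
    calc hit stepLaw n 0 ^ 2
        ≤ ENNReal.ofReal (upperConst / √((n + 1) * (scale k : ℝ) ^ 9)) ^ 2 := by
          gcongr
          exact hit_le (by omega) 0
      _ = _ := by
          rw [← ENNReal.ofReal_pow (by unfold upperConst; positivity), div_pow,
            Real.sq_sqrt (by positivity)]
          congr 1
          field_simp
  refine (Finset.sum_le_sum h1).trans ?_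
  rw [← ENNReal.ofReal_sum_of_nonneg fun n _ => by positivity]
  apply ENNReal.ofReal_le_ofReal
  rw [← Finset.mul_sum]
  have h2 : ∑ n ∈ Finset.Ico (scale k ^ 2 - 1) (scale (k + 1) ^ 2 - 1), (1 : ℝ) / (((n : ℕ) : ℝ) + 1)
      ≤ 11 * (scale k : ℝ) ^ 8 := by
    calc _ ≤ ∑ n ∈ Finset.range (scale (k + 1) ^ 2), (1 : ℝ) / ((n : ℝ) + 1) := by
          refine Finset.sum_le_sum_of_subset_of_nonneg (fun n hn => ?_) fun _ _ _ => by positivity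
          rw [Finset.mem_Ico] at hn
          rw [Finset.mem_range]; omega
      _ ≤ 1 + Real.log ((scale (k + 1) ^ 2 : ℕ) : ℝ) := sum_one_div_le_log _
      _ = 1 + 2 * Real.log (scale (k + 1)) := by push_cast; rw [Real.log_pow]; norm_num
      _ ≤ 1 + 2 * (5 * (scale k : ℝ) ^ 8) := by gcongr; exact log_scale_succ_le k
      _ ≤ _ := by have := one_le_pow₀ (n := 8) hd; linarith
  calc upperConst ^ 2 / (scale k : ℝ) ^ 9 * _
      ≤ upperConst ^ 2 / (scale k : ℝ) ^ 9 * (11 * (scale k : ℝ) ^ 8) := by gcongr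
    _ = 11 * upperConst ^ 2 * (1 / scale k) := by field_simp
    _ ≤ 11 * upperConst ^ 2 * (1 / 2) ^ k := by
        rw [one_div_pow]
        gcongr
        exact_mod_cast two_pow_le_scale k

lemma tsum_hit_sq_lt_top : ∑' n, hit stepLaw n 0 ^ 2 < ∞ := by
  have hpart : ∀ K, ∑ n ∈ Finset.range (scale K ^ 2 - 1), hit stepLaw n 0 ^ 2
      ≤ ∑ k ∈ Finset.range K, ENNReal.ofReal (11 * upperConst ^ 2 * (1 / 2) ^ k) := by
    intro K
    induction K with
    | zero => simp [scale]
    | succ K ih =>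
      have hle : scale K ^ 2 - 1 ≤ scale (K + 1) ^ 2 - 1 :=
        Nat.sub_le_sub_right (Nat.pow_le_pow_left (scale_mono (Nat.le_succ K)) 2) 1
      rw [Finset.sum_range_succ, ← Finset.sum_range_add_sum_Ico _ hle]
      exact add_le_add ih (sum_hit_sq_window_le K)
  refine lt_of_le_of_lt (ENNReal.tsum_le_of_sum_range_le
    (c := ENNReal.ofReal (11 * upperConst ^ 2 * 2)) fun n => ?_) ENNReal.ofReal_lt_top
  have hn : n ≤ scale n ^ 2 - 1 := by
    have h1 : n + 1 ≤ 2 ^ n := Nat.lt_two_pow_self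
    have h2 := two_pow_le_scale n
    have h3 : scale n ≤ scale n ^ 2 := Nat.le_self_pow two_ne_zero _
    omega
  calc _ ≤ ∑ n ∈ Finset.range (scale n ^ 2 - 1), hit stepLaw n 0 ^ 2 :=
        Finset.sum_le_sum_of_subset (Finset.range_subset_range.2 hn)
    _ ≤ _ := hpart n
    _ ≤ _ := by
        rw [← ENNReal.ofReal_sum_of_nonneg fun n _ => by positivity]
        apply ENNReal.ofReal_le_ofReal
        rw [← Finset.mul_sum]
        gcongr
        exact sum_geometric_two_le n

/-! ### Lower bounds on the return probabilities -/

/-- The restriction of the step law to the jumps of scale at most `k`. -/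
noncomputable def truncLaw (k : ℕ) : Measure ℤ :=
  mixture (fun j => if j ≤ k then weight j else 0) radius

lemma truncLaw_le (k : ℕ) : truncLaw k ≤ stepLaw := by
  intro A
  rw [truncLaw, stepLaw, mixture_apply, mixture_apply]
  refine ENNReal.tsum_le_tsum fun j => ?_
  gcongr
  split_ifs <;> simp

lemma stepOp_truncLaw (k : ℕ) (f : ℤ → ℝ≥0∞) (x : ℤ) :
    stepOp (truncLaw k) f x
      = ∑ j ∈ Finset.range (k + 1), weight j * stepOp (jump (radius j)) f x := by
  rw [truncLaw, stepOp_mixture, tsum_eq_sum (s := Finset.range (k + 1))]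
  · refine Finset.sum_congr rfl fun j hj => ?_
    rw [if_pos (Nat.lt_succ_iff.1 (Finset.mem_range.1 hj))]
  · intro j hj
    rw [if_neg (by simpa using hj), zero_mul]

lemma sum_weight (k : ℕ) :
    ∑ j ∈ Finset.range k, weight j = ENNReal.ofReal (1 - 1 / scale k) := by
  unfold weight
  rw [← ENNReal.ofReal_sum_of_nonneg fun j _ => (rate_pos j).le, sum_rate]

lemma truncLaw_univ (k : ℕ) :
    truncLaw k Set.univ = ENNReal.ofReal (1 - 1 / scale (k + 1)) := by
  have h := stepOp_truncLaw k (fun _ => 1) 0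
  simpa [stepOp, sum_weight] using h

lemma stepOp_truncLaw_iterate_one (k n : ℕ) (x : ℤ) :
    (stepOp (truncLaw k))^[n] 1 x = ENNReal.ofReal (1 - 1 / scale (k + 1)) ^ n := by
  induction n generalizing x with
  | zero => rfl
  | succ n ih =>
    rw [Function.iterate_succ_apply', stepOp]
    simp only [ih, lintegral_const, truncLaw_univ, pow_succ]

/-- The square of an integer, as an extended nonnegative number. -/
noncomputable def sqFun (x : ℤ) : ℝ≥0∞ := ENNReal.ofReal ((x : ℝ) ^ 2)

lemma stepOp_unif_sqFun_le (a : ℕ) (x : ℤ) :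
    stepOp (unif a) sqFun x ≤ sqFun x + ENNReal.ofReal ((a : ℝ) ^ 2) := by
  rw [stepOp_unif]
  unfold sqFun
  rw [← ENNReal.ofReal_sum_of_nonneg fun _ _ => sq_nonneg _,
    ← ENNReal.ofReal_add (sq_nonneg _) (sq_nonneg _)]
  have hneg : ∑ v ∈ Finset.Icc (-a : ℤ) a, (v : ℝ) = 0 := by
    have h : ∑ v ∈ Finset.Icc (-a : ℤ) a, (v : ℝ) = ∑ v ∈ Finset.Icc (-a : ℤ) a, -(v : ℝ) := by
      refine Finset.sum_bij' (fun v _ => -v) (fun v _ => -v) ?_ ?_ ?_ ?_ ?_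
      · intro v hv; simp only [Finset.mem_Icc] at hv ⊢; omega
      · intro v hv; simp only [Finset.mem_Icc] at hv ⊢; omega
      · simp
      · simp
      · simp
    rw [Finset.sum_neg_distrib] at h
    linarith
  have hcard : ((Finset.Icc (-a : ℤ) a).card : ℝ) = 2 * a + 1 := by
    rw [Int.card_Icc, show ((a : ℤ) + 1 - -a).toNat = 2 * a + 1 by omega]
    push_cast; rfl
  have h : ∑ v ∈ Finset.Icc (-a : ℤ) a, ((x + v : ℤ) : ℝ) ^ 2
      ≤ (2 * a + 1) * ((x : ℝ) ^ 2 + (a : ℝ) ^ 2) := by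
    have e : ∀ v : ℤ, ((x + v : ℤ) : ℝ) ^ 2 = (x : ℝ) ^ 2 + 2 * x * v + (v : ℝ) ^ 2 :=
      fun v => by push_cast; ring
    simp only [e, Finset.sum_add_distrib, ← Finset.mul_sum, hneg, Finset.sum_const, nsmul_eq_mul,
      hcard]
    have : ∑ v ∈ Finset.Icc (-a : ℤ) a, (v : ℝ) ^ 2 ≤ ∑ v ∈ Finset.Icc (-a : ℤ) a, (a : ℝ) ^ 2 := by
      refine Finset.sum_le_sum fun v hv => ?_
      rw [Finset.mem_Icc] at hv
      exact sq_le_sq' (by exact_mod_cast hv.1) (by exact_mod_cast hv.2)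
    rw [Finset.sum_const, nsmul_eq_mul, hcard] at this
    linarith
  have h2 : (2 * a + 1 : ℝ≥0∞) = ENNReal.ofReal (2 * a + 1) := by
    rw [ENNReal.ofReal_add (by positivity) (by norm_num), ENNReal.ofReal_mul (by norm_num)]
    simp
  rw [mul_comm, ← div_eq_mul_inv, ENNReal.div_le_iff (window_ne_zero a) (window_ne_top a), h2,
    ← ENNReal.ofReal_mul (by positivity), mul_comm _ (2 * (a : ℝ) + 1)]
  exact ENNReal.ofReal_le_ofReal h

lemma stepOp_jump_sqFun_le (a : ℕ) (x : ℤ) :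
    stepOp (jump a) sqFun x ≤ sqFun x + ENNReal.ofReal ((3 * a + 1 : ℝ) ^ 2) := by
  rw [stepOp_jump]
  have h1 : stepOp (unif a) sqFun x ≤ sqFun x + ENNReal.ofReal ((3 * a + 1 : ℝ) ^ 2) := by
    refine (stepOp_unif_sqFun_le a x).trans ?_
    gcongr
    have : (0 : ℝ) ≤ a := by positivity
    linarith
  have h2 : stepOp (unif (3 * a + 1)) sqFun x
      ≤ sqFun x + ENNReal.ofReal ((3 * a + 1 : ℝ) ^ 2) := by
    refine (stepOp_unif_sqFun_le _ x).trans_eq ?_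
    push_cast; rfl
  calc _ ≤ 1 / 4 * (sqFun x + ENNReal.ofReal ((3 * a + 1 : ℝ) ^ 2))
        + 3 / 4 * (sqFun x + ENNReal.ofReal ((3 * a + 1 : ℝ) ^ 2)) := by gcongr
    _ = _ := by rw [← add_mul, quarter_add_three_quarters, one_mul]

lemma sum_scale_pow_le (k : ℕ) :
    ∑ j ∈ Finset.range (k + 1), 16 * (scale j : ℝ) ^ 9 ≤ 32 * (scale k : ℝ) ^ 9 := by
  induction k with
  | zero => simp [scale]; norm_num
  | succ k ih =>
    rw [Finset.sum_range_succ]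
    have h := pow_le_pow_left₀ (by positivity) (two_mul_scale_le_real k) 9
    rw [mul_pow] at h
    have h0 : (0 : ℝ) ≤ (scale k : ℝ) ^ 9 := by positivity
    linarith

/-- Scale `j` contributes at most `(1/d_j) (4 d_j^5)^2 = 16 d_j^9` to the second moment, and since
scales at least double, the top one dominates the sum. -/
lemma stepOp_truncLaw_sqFun_le (k : ℕ) (x : ℤ) :
    stepOp (truncLaw k) sqFun x ≤ sqFun x + ENNReal.ofReal (32 * (scale k : ℝ) ^ 9) := by
  rw [stepOp_truncLaw]
  calc _ ≤ ∑ j ∈ Finset.range (k + 1), (weight j * sqFun x + ENNReal.ofReal (16 * (scale j : ℝ) ^ 9)) := by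
        refine Finset.sum_le_sum fun j _ => ?_
        refine (mul_le_mul' le_rfl (stepOp_jump_sqFun_le _ x)).trans ?_
        rw [mul_add]
        gcongr
        rw [weight, ← ENNReal.ofReal_mul (rate_pos j).le]
        apply ENNReal.ofReal_le_ofReal
        have hd := one_le_scale_real j
        have h5 : (1 : ℝ) ≤ (scale j : ℝ) ^ 5 := one_le_pow₀ hd
        calc rate j * (3 * (radius j : ℝ) + 1) ^ 2
            ≤ 1 / scale j * (4 * (scale j : ℝ) ^ 5) ^ 2 := by
              gcongr
              · exact rate_le j
              · simp only [radius, Nat.cast_pow]; linarith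
          _ = 16 * (scale j : ℝ) ^ 9 := by field_simp; ring
    _ ≤ _ := by
        rw [Finset.sum_add_distrib, ← Finset.sum_mul, sum_weight,
          ← ENNReal.ofReal_sum_of_nonneg fun j _ => by positivity]
        gcongr ?_ + ENNReal.ofReal ?_
        · refine mul_le_of_le_one_left' ?_
          rw [ENNReal.ofReal_le_one]
          have : (0 : ℝ) ≤ 1 / scale (k + 1) := by positivity
          linarith
        · exact sum_scale_pow_le k

lemma stepOp_truncLaw_iterate_sqFun_le (k n : ℕ) :
    (stepOp (truncLaw k))^[n] sqFun 0 ≤ ENNReal.ofReal (n * (32 * (scale k : ℝ) ^ 9)) := by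
  have key : ∀ x, (stepOp (truncLaw k))^[n] sqFun x
      ≤ sqFun x + n * ENNReal.ofReal (32 * (scale k : ℝ) ^ 9) := by
    induction n with
    | zero => simp
    | succ n ih =>
      intro x
      rw [Function.iterate_succ_apply']
      have h1 : (stepOp (truncLaw k))^[n] sqFun
          ≤ sqFun + fun _ => n * ENNReal.ofReal (32 * (scale k : ℝ) ^ 9) := ih
      refine (stepOp_mono le_rfl h1 x).trans ?_
      rw [stepOp_add, Pi.add_apply]
      have h2 : stepOp (truncLaw k) (fun _ => n * ENNReal.ofReal (32 * (scale k : ℝ) ^ 9)) x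
          ≤ n * ENNReal.ofReal (32 * (scale k : ℝ) ^ 9) := by
        rw [stepOp, lintegral_const]
        refine mul_le_of_le_one_right' ?_
        rw [← measure_univ (μ := stepLaw)]
        exact truncLaw_le k _
      refine (add_le_add (stepOp_truncLaw_sqFun_le k x) h2).trans_eq ?_
      push_cast; ring
  refine (key 0).trans_eq ?_
  rw [ENNReal.ofReal_mul (by positivity)]
  simp [sqFun]

/-- Chebyshev's inequality for the walk without large jumps. -/
lemma half_le_stepOp_iterate {k n R : ℕ} (hn : 4 * n ≤ scale (k + 1)) (hR0 : R ≠ 0)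
    (hR : 128 * (n * (scale k : ℝ) ^ 9) ≤ (R : ℝ) ^ 2) :
    ENNReal.ofReal (1 / 2) ≤ (stepOp stepLaw)^[n] (ind (Finset.Icc (-R : ℤ) R)) 0 := by
  refine le_trans ?_ (stepOp_iterate_mono (truncLaw_le k) le_rfl n 0)
  have hR1 : (0 : ℝ) < (R : ℝ) ^ 2 := by positivity
  -- Chebyshev in pointwise form. Applied to the sub-probability law `truncLaw k`, the left side
  -- becomes the mass surviving `n` steps (at least 3/4) and the quadratic term costs at most 1/4.
  have h1 : (1 : ℤ → ℝ≥0∞) ≤ ind (Finset.Icc (-R : ℤ) R)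
      + ENNReal.ofReal (1 / (R : ℝ) ^ 2) • sqFun := by
    intro x
    simp only [Pi.one_apply, Pi.add_apply, Pi.smul_apply, smul_eq_mul]
    by_cases hx : x ∈ Finset.Icc (-R : ℤ) R
    · refine le_add_right ?_
      rw [ind, Set.indicator_of_mem (by simpa using hx)]; rfl
    · refine le_add_left ?_
      rw [sqFun, ← ENNReal.ofReal_mul (by positivity), ENNReal.one_le_ofReal, one_div_mul_eq_div,
        one_le_div hR1]
      rw [Finset.mem_Icc, ← abs_le, not_le] at hx
      rw [← sq_abs (x : ℝ)]
      gcongr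
      exact_mod_cast hx.le
  have hsmul : ∀ (c : ℝ≥0∞) (f : ℤ → ℝ≥0∞) (m : ℕ),
      (stepOp (truncLaw k))^[m] (c • f) = c • (stepOp (truncLaw k))^[m] f := fun c f m => by
    induction m with
    | zero => rfl
    | succ m ih => simp only [Function.iterate_succ_apply', ih, stepOp_smul]
  have h2 := stepOp_iterate_mono (le_refl (truncLaw k)) h1 n 0
  rw [stepOp_truncLaw_iterate_one, stepOp_iterate_add, hsmul, Pi.add_apply, Pi.smul_apply,
    smul_eq_mul] at h2
  have hs : (4 * n : ℝ) ≤ scale (k + 1) := by exact_mod_cast hn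
  have hs0 := one_le_scale_real (k + 1)
  have h3 : ENNReal.ofReal (3 / 4) ≤ ENNReal.ofReal (1 - 1 / scale (k + 1)) ^ n := by
    have h4 : (0 : ℝ) ≤ 1 - 1 / scale (k + 1) := by
      rw [sub_nonneg, div_le_one (by linarith)]; exact hs0
    rw [← ENNReal.ofReal_pow h4]
    apply ENNReal.ofReal_le_ofReal
    have h5 := one_add_mul_le_pow (a := -(1 / (scale (k + 1) : ℝ))) (by linarith) n
    have h6 : (n : ℝ) * (1 / scale (k + 1)) ≤ 1 / 4 := by
      rw [mul_one_div, div_le_div_iff₀ (by linarith) (by norm_num)]; linarith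
    rw [← sub_eq_add_neg] at h5
    linarith
  have h7 : ENNReal.ofReal (1 / (R : ℝ) ^ 2) * (stepOp (truncLaw k))^[n] sqFun 0
      ≤ ENNReal.ofReal (1 / 4) := by
    refine (mul_le_mul' le_rfl (stepOp_truncLaw_iterate_sqFun_le k n)).trans ?_
    rw [← ENNReal.ofReal_mul (by positivity)]
    apply ENNReal.ofReal_le_ofReal
    rw [one_div_mul_eq_div, div_le_div_iff₀ hR1 (by norm_num)]
    linarith
  have h8 := (h3.trans h2).trans (add_le_add le_rfl h7)
  have h9 : ENNReal.ofReal (3 / 4) = ENNReal.ofReal (1 / 2) + ENNReal.ofReal (1 / 4) := by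
    rw [← ENNReal.ofReal_add (by norm_num) (by norm_num)]; norm_num
  rw [h9] at h8
  exact (ENNReal.add_le_add_iff_right ENNReal.ofReal_ne_top).1 h8

/-- By unimodality, points within distance `H` of the origin are at most as likely as 0, and points
further out at most as likely as `x`. If the central part is negligible, this bounds the probability
at `x` from below. -/
lemma stepOp_iterate_window_le (n R H : ℕ) {x : ℤ} (hx : |x| ≤ H) :
    (stepOp stepLaw)^[n] (ind (Finset.Icc (-R : ℤ) R)) 0
      ≤ (2 * H + 1) * hit stepLaw n 0 + (2 * R + 1) * hit stepLaw n x := by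
  rw [stepOp_iterate_ind_finset]
  have hu := isUnimodal_hit n
  have h1 : ∀ z : ℤ, hit stepLaw n (0 - z)
      ≤ (if z ∈ Finset.Icc (-H : ℤ) H then hit stepLaw n 0 else 0) + hit stepLaw n x := fun z => by
    split_ifs with hz
    · exact le_add_right (hu.le_zero _)
    · rw [zero_add]
      rw [Finset.mem_Icc, ← abs_le, not_le] at hz
      exact hu _ _ (by rw [zero_sub, abs_neg]; exact hx.trans hz.le)
  refine (Finset.sum_le_sum fun z _ => h1 z).trans ?_
  rw [Finset.sum_add_distrib, Finset.sum_const, nsmul_eq_mul, card_window, Finset.sum_ite_mem]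
  gcongr
  rw [Finset.sum_const, nsmul_eq_mul]
  gcongr
  rw [← card_window]
  exact_mod_cast Finset.card_le_card Finset.inter_subset_right

/-- The constant in the local lower bound. -/
noncomputable def lowerConst : ℝ := 1 / 108

lemma le_hit {k n : ℕ} (hk : 400 * upperConst ^ 2 ≤ scale k) (h1 : scale k ^ 2 ≤ n)
    (h2 : 4 * n ≤ scale (k + 1)) {x : ℤ} (hx : |x| ≤ (2 * radius k : ℕ)) :
    ENNReal.ofReal (lowerConst / √(n * (scale k : ℝ) ^ 9)) ≤ hit stepLaw n x := by
  have hd := one_le_scale_real k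
  have hA : 0 < upperConst := by unfold upperConst; norm_num
  have hU := hit_le (k := k) (n := n) (h1.trans (Nat.le_succ n)) 0
  set d : ℝ := (scale k : ℝ) with hd'
  have hN : d ^ 2 ≤ (n : ℝ) := by rw [hd']; exact_mod_cast h1
  have hd2 : (1 : ℝ) ≤ d ^ 2 := one_le_pow₀ hd
  have hn1 : (1 : ℝ) ≤ n := hd2.trans hN
  set s := √(n * d ^ 9) with hs
  have hs2 : s ^ 2 = n * d ^ 9 := Real.sq_sqrt (by positivity)
  have hs1 : 1 ≤ s := by
    rw [hs, Real.one_le_sqrt]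
    exact one_le_mul_of_one_le_of_one_le hn1 (one_le_pow₀ hd)
  -- Since `12^2 ≥ 128`, Chebyshev applies; since `s ≥ 1`, the window has at most `27 s` points.
  -- This gives `lowerConst = (1/4)/27`.
  set R : ℕ := ⌈12 * s⌉₊ with hRdef
  have hR1 : 12 * s ≤ R := Nat.le_ceil _
  have hR2 : (R : ℝ) < 12 * s + 1 := Nat.ceil_lt_add_one (by positivity)
  have hR0 : R ≠ 0 := by
    intro h; rw [h] at hR1; norm_num at hR1; linarith
  have hhalf := half_le_stepOp_iterate h2 hR0 (by rw [← hd', ← hs2]; nlinarith)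
  have hwin := hhalf.trans (stepOp_iterate_window_le n R (2 * radius k) hx)
  -- The central part has about `4 d^5` points, each of probability at most `upperConst / √(d^11)`
  -- because `n ≥ d^2`. The hypothesis `hk` makes the resulting factor `d^(-1/2)` small enough.
  have hq : (2 * (2 * radius k : ℕ) + 1 : ℝ≥0∞) * hit stepLaw n 0 ≤ ENNReal.ofReal (1 / 4) := by
    have e : (2 * (2 * radius k : ℕ) + 1 : ℝ≥0∞) = ENNReal.ofReal (4 * d ^ 5 + 1) := by
      have : (4 * d ^ 5 + 1 : ℝ) = ((2 * (2 * radius k) + 1 : ℕ) : ℝ) := by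
        simp only [radius, hd']; push_cast; ring
      rw [this, ENNReal.ofReal_natCast]; push_cast; rfl
    rw [e]
    refine (mul_le_mul' le_rfl hU).trans ?_
    rw [← ENNReal.ofReal_mul (by positivity)]
    apply ENNReal.ofReal_le_ofReal
    have h5 : 20 * upperConst * d ^ 5 ≤ √((n + 1) * d ^ 9) := by
      apply Real.le_sqrt_of_sq_le
      calc (20 * upperConst * d ^ 5) ^ 2 = (400 * upperConst ^ 2) * d ^ 10 := by ring
        _ ≤ d * d ^ 10 := by gcongr
        _ = d ^ 2 * d ^ 9 := by ring
        _ ≤ (n + 1) * d ^ 9 := by gcongr; linarith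
    have h6 : 0 < √((n + 1) * d ^ 9) := Real.sqrt_pos.2 (by positivity)
    rw [mul_div_assoc', div_le_div_iff₀ h6 (by norm_num)]
    have h7 : (1 : ℝ) ≤ d ^ 5 := one_le_pow₀ hd
    nlinarith
  have h8 := hwin.trans (add_le_add hq le_rfl)
  have h9 : ENNReal.ofReal (1 / 2) = ENNReal.ofReal (1 / 4) + ENNReal.ofReal (1 / 4) := by
    rw [← ENNReal.ofReal_add (by norm_num) (by norm_num)]; norm_num
  rw [h9, ENNReal.add_le_add_iff_left ENNReal.ofReal_ne_top] at h8
  have h10 : (2 * R + 1 : ℝ≥0∞) ≤ ENNReal.ofReal (27 * s) := by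
    have : (2 * R + 1 : ℝ≥0∞) = ENNReal.ofReal (2 * R + 1) := by
      rw [ENNReal.ofReal_add (by positivity) (by norm_num), ENNReal.ofReal_mul (by norm_num)]
      simp
    rw [this]
    apply ENNReal.ofReal_le_ofReal
    linarith
  have h11 := h8.trans (mul_le_mul' h10 le_rfl)
  have e2 : ENNReal.ofReal (lowerConst / s) = (ENNReal.ofReal (27 * s))⁻¹ * ENNReal.ofReal (1 / 4) := by
    rw [← ENNReal.ofReal_inv_of_pos (by positivity), ← ENNReal.ofReal_mul (by positivity)]
    congr 1
    unfold lowerConst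
    field_simp; norm_num
  rw [e2]
  refine (mul_le_mul' le_rfl h11).trans_eq ?_
  rw [← mul_assoc, ENNReal.inv_mul_cancel, one_mul]
  · simp; linarith
  · exact ENNReal.ofReal_ne_top

/-! ### The second moment method -/

lemma sum_sum_real_inter_le {Ω : Type*} [MeasurableSpace Ω] {P : Measure Ω} {J : ℕ}
    {E : ℕ → Set Ω} {b : ℕ → ℝ} (hb : ∀ l, 0 ≤ b l)
    (hE : ∀ i j, i < j → j < J → P.real (E i ∩ E j) ≤ P.real (E i) * b (j - i)) :
    ∑ i ∈ Finset.range J, ∑ j ∈ Finset.range J, P.real (E i ∩ E j)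
      ≤ (∑ i ∈ Finset.range J, P.real (E i)) * (1 + 2 * ∑ l ∈ Finset.range J, b (l + 1)) := by
  set B := ∑ l ∈ Finset.range J, b (l + 1) with hB
  have hpoint : ∀ i ∈ Finset.range J, ∀ j ∈ Finset.range J, P.real (E i ∩ E j)
      ≤ (if i = j then P.real (E i) else 0) + (if i < j then P.real (E i) * b (j - i) else 0)
        + (if j < i then P.real (E j) * b (i - j) else 0) := by
    intro i hi j hj
    rw [Finset.mem_range] at hi hj
    rcases lt_trichotomy i j with h | h | h
    · simpa [h, h.ne, h.not_gt] using hE i j h hj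
    · simp [h]
    · rw [Set.inter_comm]
      simpa [h, h.ne', h.not_gt] using hE j i h hi
  have hinner : ∀ i, ∑ j ∈ Finset.range J, (if i < j then P.real (E i) * b (j - i) else 0)
      ≤ P.real (E i) * B := by
    intro i
    rw [← Finset.sum_filter, ← Finset.mul_sum]
    refine mul_le_mul_of_nonneg_left ?_ measureReal_nonneg
    have : (Finset.range J).filter (fun j => i < j) = Finset.Ico (i + 1) J := by
      ext j; simp only [Finset.mem_filter, Finset.mem_range, Finset.mem_Ico]; omega
    rw [this, Finset.sum_Ico_eq_sum_range]
    have e : ∀ l, i + 1 + l - i = l + 1 := fun l => by omega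
    simp only [e]
    exact Finset.sum_le_sum_of_subset_of_nonneg (Finset.range_subset_range.2 (Nat.sub_le _ _))
      fun _ _ _ => hb _
  refine (Finset.sum_le_sum fun i hi => Finset.sum_le_sum (hpoint i hi)).trans ?_
  simp only [Finset.sum_add_distrib]
  have h1 : ∑ i ∈ Finset.range J, ∑ j ∈ Finset.range J, (if i = j then P.real (E i) else 0)
      = ∑ i ∈ Finset.range J, P.real (E i) := by
    refine Finset.sum_congr rfl fun i hi => ?_
    rw [Finset.sum_ite_eq, if_pos hi]
  have h2 := Finset.sum_le_sum fun i (_ : i ∈ Finset.range J) => hinner i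
  rw [Finset.sum_comm (f := fun i j => if j < i then P.real (E j) * b (i - j) else 0), h1]
  rw [← Finset.sum_mul] at h2
  linarith

lemma le_real_iUnion_of_second_moment {Ω : Type*} [MeasurableSpace Ω] {P : Measure Ω}
    [IsProbabilityMeasure P] {J : ℕ} {E : ℕ → Set Ω} (hm : ∀ i, MeasurableSet (E i)) {b : ℕ → ℝ}
    (hb : ∀ l, 0 ≤ b l)
    (hE : ∀ i j, i < j → j < J → P.real (E i ∩ E j) ≤ P.real (E i) * b (j - i)) {C : ℝ}
    (hC0 : 0 ≤ C)
    (hC : ∑ l ∈ Finset.range J, b (l + 1) ≤ C * ∑ i ∈ Finset.range J, P.real (E i))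
    (hone : 1 ≤ ∑ i ∈ Finset.range J, P.real (E i)) :
    1 / (1 + 2 * C) ≤ P.real (⋃ i ∈ Finset.range J, E i) := by
  have hS := sum_sum_real_inter_le hb hE
  set m := ∑ i ∈ Finset.range J, P.real (E i)
  set S := ∑ i ∈ Finset.range J, ∑ j ∈ Finset.range J, P.real (E i ∩ E j)
  set F := ⋃ i ∈ Finset.range J, E i
  have hF : MeasurableSet F := Finset.measurableSet_biUnion _ fun i _ => hm i
  have hS2 : S ≤ m ^ 2 * (1 + 2 * C) := by
    calc S ≤ m * (1 + 2 * (C * m)) := hS.trans (by gcongr)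
      _ ≤ m * (m + 2 * (C * m)) := by gcongr
      _ = _ := by ring
  have hint : ∀ A : Set Ω, MeasurableSet A → Integrable (A.indicator (1 : Ω → ℝ)) P :=
    fun A hA => (integrable_const 1).indicator hA
  -- With `N` the number of events that occur, `2αN - (αN)^2 ≤ 1`, and the left side vanishes when
  -- `N = 0`. Taking expectations avoids Cauchy–Schwarz; the choice of `α` below optimises against
  -- the bound `hS2` on `S`.
  have key : ∀ α : ℝ, 2 * α * m - α ^ 2 * S ≤ P.real F := by
    intro α
    have e1 : ∫ ω, (2 * α * ∑ i ∈ Finset.range J, (E i).indicator (1 : Ω → ℝ) ω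
        - α ^ 2 * ∑ i ∈ Finset.range J, ∑ j ∈ Finset.range J,
          (E i ∩ E j).indicator (1 : Ω → ℝ) ω) ∂P = 2 * α * m - α ^ 2 * S := by
      rw [integral_sub, integral_const_mul, integral_const_mul, integral_finsetSum,
        integral_finsetSum]
      · congr 2
        · exact Finset.sum_congr rfl fun i _ => integral_indicator_one (hm i)
        · refine Finset.sum_congr rfl fun i _ => ?_
          rw [integral_finsetSum _ fun j _ => hint _ ((hm i).inter (hm j))]
          exact Finset.sum_congr rfl fun j _ => integral_indicator_one ((hm i).inter (hm j))
      · exact fun i _ => integrable_finsetSum _ fun j _ => hint _ ((hm i).inter (hm j))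
      · exact fun i _ => hint _ (hm i)
      · exact (integrable_finsetSum _ fun i _ => hint _ (hm i)).const_mul _
      · exact (integrable_finsetSum _ fun i _ => integrable_finsetSum _ fun j _ =>
          hint _ ((hm i).inter (hm j))).const_mul _
    rw [← e1, ← integral_indicator_one hF]
    refine integral_mono ?_ (hint F hF) fun ω => ?_
    · exact ((integrable_finsetSum _ fun i _ => hint _ (hm i)).const_mul _).sub
        ((integrable_finsetSum _ fun i _ => integrable_finsetSum _ fun j _ =>
          hint _ ((hm i).inter (hm j))).const_mul _)
    · have e2 : ∑ i ∈ Finset.range J, ∑ j ∈ Finset.range J, (E i ∩ E j).indicator (1 : Ω → ℝ) ω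
          = (∑ i ∈ Finset.range J, (E i).indicator (1 : Ω → ℝ) ω) ^ 2 := by
        rw [sq, Finset.sum_mul_sum]
        refine Finset.sum_congr rfl fun i _ => Finset.sum_congr rfl fun j _ => ?_
        rw [Set.inter_indicator_one]; rfl
      simp only [e2]
      by_cases hω : ω ∈ F
      · rw [Set.indicator_of_mem hω, Pi.one_apply]
        nlinarith [sq_nonneg (α * (∑ i ∈ Finset.range J, (E i).indicator (1 : Ω → ℝ) ω) - 1)]
      · have : ∑ i ∈ Finset.range J, (E i).indicator (1 : Ω → ℝ) ω = 0 := by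
          refine Finset.sum_eq_zero fun i hi => Set.indicator_of_notMem (fun h => hω ?_) _
          exact Set.mem_biUnion hi h
        rw [this, Set.indicator_of_notMem hω]
        simp
  have hm0 : 0 < m := by linarith
  have hC1 : 0 < 1 + 2 * C := by linarith
  refine le_trans ?_ (key (1 / (m * (1 + 2 * C))))
  have h1 : (1 / (m * (1 + 2 * C))) ^ 2 * S
      ≤ (1 / (m * (1 + 2 * C))) ^ 2 * (m ^ 2 * (1 + 2 * C)) := by gcongr
  have h2 : (1 / (m * (1 + 2 * C))) ^ 2 * (m ^ 2 * (1 + 2 * C)) = 1 / (1 + 2 * C) := by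
    field_simp
  have h3 : 2 * (1 / (m * (1 + 2 * C))) * m = 2 * (1 / (1 + 2 * C)) := by field_simp
  linarith

/-! ### Crossings of zero by large jumps while the other walk stays at zero -/

lemma unif_apply (a : ℕ) (A : Set ℤ) :
    unif a A = (2 * a + 1 : ℝ≥0∞)⁻¹ * ∑ v ∈ Finset.Icc (-a : ℤ) a, ind A v := by
  rw [← lintegral_unif, ind, lintegral_indicator_one MeasurableSet.of_discrete]

lemma third_le_unif (h : ℕ) : (3 : ℝ≥0∞)⁻¹ ≤ unif (3 * h + 1) (Set.Iio (-h : ℤ)) := by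
  rw [unif_apply]
  have h1 : Finset.Icc (-(3 * h + 1 : ℕ) : ℤ) (-h - 1)
      ⊆ Finset.Icc (-(3 * h + 1 : ℕ) : ℤ) (3 * h + 1 : ℕ) := by
    intro v hv; simp only [Finset.mem_Icc] at hv ⊢; omega
  have h2 : (2 * h + 1 : ℝ≥0∞)
      ≤ ∑ v ∈ Finset.Icc (-(3 * h + 1 : ℕ) : ℤ) (3 * h + 1 : ℕ), ind (Set.Iio (-h : ℤ)) v := by
    refine le_trans ?_ (Finset.sum_le_sum_of_subset h1)
    have h3 : ∀ v ∈ Finset.Icc (-(3 * h + 1 : ℕ) : ℤ) (-h - 1), ind (Set.Iio (-h : ℤ)) v = 1 := by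
      intro v hv
      rw [Finset.mem_Icc] at hv
      exact Set.indicator_of_mem (by rw [Set.mem_Iio]; omega) _
    rw [Finset.sum_congr rfl h3, Finset.sum_const, nsmul_eq_mul, mul_one, Int.card_Icc,
      show ((-h - 1 + 1 - -(3 * h + 1 : ℕ) : ℤ)).toNat = 2 * h + 1 by omega]
    push_cast; rfl
  refine le_trans ?_ (mul_le_mul' le_rfl h2)
  have : (2 * (3 * h + 1 : ℕ) + 1 : ℝ≥0∞) = 3 * (2 * h + 1) := by push_cast; ring
  rw [this, ENNReal.mul_inv (by simp) (by simp), mul_assoc,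
    ENNReal.inv_mul_cancel (window_ne_zero h) (window_ne_top h), mul_one]

/-- Only the wide component of `jump (radius k)`, of weight 3/4, is used: a third of it lies below
`-radius k`. -/
lemma le_stepLaw_Iio (k : ℕ) :
    1 / (8 * (scale k : ℝ)) ≤ stepLaw.real (Set.Iio (-radius k : ℤ)) := by
  have h1 : ENNReal.ofReal (rate k / 4) ≤ stepLaw (Set.Iio (-radius k : ℤ)) := by
    rw [stepLaw, mixture_apply]
    refine le_trans ?_ (ENNReal.le_tsum k)
    rw [div_eq_mul_inv, ENNReal.ofReal_mul (rate_pos k).le]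
    refine mul_le_mul' le_rfl ?_
    have h2 : ENNReal.ofReal (4⁻¹ : ℝ) = 3 / 4 * (3 : ℝ≥0∞)⁻¹ := by
      rw [ENNReal.ofReal_inv_of_pos (by norm_num), div_eq_mul_inv, mul_right_comm,
        ENNReal.mul_inv_cancel (by simp) (by simp), one_mul]
      simp
    rw [h2, jump, Measure.add_apply, Measure.smul_apply, Measure.smul_apply, smul_eq_mul,
      smul_eq_mul]
    exact le_add_left (mul_le_mul' le_rfl (third_le_unif _))
  have h3 : rate k / 4 ≤ stepLaw.real (Set.Iio (-radius k : ℤ)) :=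
    (ENNReal.ofReal_le_iff_le_toReal (measure_ne_top _ _)).1 h1
  have h4 := le_rate k
  have h5 : 1 / (8 * (scale k : ℝ)) = 1 / (2 * scale k) / 4 := by field_simp; norm_num
  linarith

lemma stepLaw_zero_pos : 0 < stepLaw.real {0} := by
  refine ENNReal.toReal_pos ?_ (measure_ne_top _ _)
  rw [stepLaw, mixture_apply]
  refine ne_of_gt (lt_of_lt_of_le ?_ (ENNReal.le_tsum 0))
  refine ENNReal.mul_pos (by simp [weight, rate_pos]) ?_
  rw [jump, Measure.add_apply, Measure.smul_apply, Measure.smul_apply, smul_eq_mul, smul_eq_mul]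
  refine ne_of_gt (lt_of_lt_of_le ?_ (le_add_right le_rfl))
  refine ENNReal.mul_pos (by simp) ?_
  rw [unif_apply]
  refine (ENNReal.mul_pos (by simp [ENNReal.add_eq_top, ENNReal.mul_eq_top]) ?_).ne'
  refine ne_of_gt (lt_of_lt_of_le (b := ind {0} (0 : ℤ)) (by simp [ind]) ?_)
  exact Finset.single_le_sum (f := fun v => ind {0} v) (fun _ _ => zero_le) (by simp)

section Crossing

variable {Ω : Type*} [MeasurableSpace Ω] {P : Measure Ω}

/-- The first walk, started from `x`, is in `(0, h]` at time `n` and makes a step below `-h`, and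
the second walk, started from `y`, is at `0` at time `n` and makes a zero step. -/
def jumpOver (X Y : ℕ → Ω → ℤ) (x y : ℤ) (h n : ℕ) : Set Ω :=
  stepEvent X x (Set.Ioc 0 h) (Set.Iio (-h)) n ∩ stepEvent Y y {0} {0} n

lemma real_inter_of_indep [IsProbabilityMeasure P] {X Y : ℕ → Ω → ℤ}
    (hXY : IndepFun (fun ω i => X i ω) (fun ω i => Y i ω) P) {A B : Set (ℕ → ℤ)}
    (hA : MeasurableSet A) (hB : MeasurableSet B) :
    P.real ({ω | (fun i => X i ω) ∈ A} ∩ {ω | (fun i => Y i ω) ∈ B})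
      = P.real {ω | (fun i => X i ω) ∈ A} * P.real {ω | (fun i => Y i ω) ∈ B} := by
  have := hXY.measure_inter_preimage_eq_mul A B hA hB
  simp only [Measure.real, ← ENNReal.toReal_mul]
  exact congrArg ENNReal.toReal this

/-- The set of step sequences such that the walk started from `x` is in `C` at time `n` and then
makes a step in `D`. -/
def stepSet (x : ℤ) (C D : Set ℤ) (n : ℕ) : Set (ℕ → ℤ) :=
  {u | x + ∑ i ∈ Finset.range n, u i ∈ C ∧ u n ∈ D}

lemma measurableSet_stepSet (x : ℤ) (C D : Set ℤ) (n : ℕ) : MeasurableSet (stepSet x C D n) := by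
  have h1 : Measurable fun u : ℕ → ℤ => ∑ i ∈ Finset.range n, u i :=
    Finset.measurable_sum _ fun i _ => measurable_pi_apply i
  exact (h1 (MeasurableSet.of_discrete (s := {z | x + z ∈ C}))).inter
    (measurable_pi_apply n (MeasurableSet.of_discrete (s := D)))

variable [IsProbabilityMeasure P] {X Y : ℕ → Ω → ℤ}

lemma real_jumpOver (hXY : IndepFun (fun ω i => X i ω) (fun ω i => Y i ω) P) (x y : ℤ)
    (h n : ℕ) : P.real (jumpOver X Y x y h n)
      = P.real (stepEvent X x (Set.Ioc 0 h) (Set.Iio (-h)) n) * P.real (stepEvent Y y {0} {0} n) :=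
  real_inter_of_indep hXY (measurableSet_stepSet _ _ _ _) (measurableSet_stepSet _ _ _ _)

lemma real_jumpOver_inter (hXY : IndepFun (fun ω i => X i ω) (fun ω i => Y i ω) P) (x y : ℤ)
    (h n m : ℕ) : P.real (jumpOver X Y x y h n ∩ jumpOver X Y x y h m)
      = P.real (stepEvent X x (Set.Ioc 0 h) (Set.Iio (-h)) n
          ∩ stepEvent X x (Set.Ioc 0 h) (Set.Iio (-h)) m)
        * P.real (stepEvent Y y {0} {0} n ∩ stepEvent Y y {0} {0} m) := by
  rw [jumpOver, jumpOver, Set.inter_inter_inter_comm]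
  exact real_inter_of_indep hXY
    ((measurableSet_stepSet _ _ _ _).inter (measurableSet_stepSet _ _ _ _))
    ((measurableSet_stepSet _ _ _ _).inter (measurableSet_stepSet _ _ _ _))

lemma stepOp_iterate_Ioc (n h : ℕ) (x : ℤ) :
    (stepOp stepLaw)^[n] (ind (Set.Ioc 0 h)) x
      = ∑ z ∈ Finset.Ioc (0 : ℤ) h, hit stepLaw n (x - z) := by
  rw [← stepOp_iterate_ind_finset, Finset.coe_Ioc]

lemma stepOp_iterate_Ioc_le {n : ℕ} {c : ℝ} (hc : ∀ z, hit stepLaw n z ≤ ENNReal.ofReal c)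
    (h : ℕ) (x : ℤ) : (stepOp stepLaw)^[n] (ind (Set.Ioc 0 h)) x ≤ ENNReal.ofReal (h * c) := by
  rw [stepOp_iterate_Ioc]
  refine (Finset.sum_le_card_nsmul _ _ _ fun z _ => hc _).trans_eq ?_
  rw [Int.card_Ioc, nsmul_eq_mul, ENNReal.ofReal_mul (by positivity)]
  simp

/-- Displacements from `[-h, h]` to `(0, h]` have size at most `2h`, hence the range required in
`hc`. -/
lemma le_stepOp_iterate_Ioc {n h : ℕ} {c : ℝ}
    (hc : ∀ z : ℤ, |z| ≤ (2 * h : ℕ) → ENNReal.ofReal c ≤ hit stepLaw n z) {x : ℤ} (hx : |x| ≤ h) :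
    ENNReal.ofReal (h * c) ≤ (stepOp stepLaw)^[n] (ind (Set.Ioc 0 h)) x := by
  rw [stepOp_iterate_Ioc]
  refine le_trans (le_of_eq ?_) (Finset.card_nsmul_le_sum _ _ (ENNReal.ofReal c) fun z hz => hc _ ?_)
  · rw [Int.card_Ioc, nsmul_eq_mul, ENNReal.ofReal_mul (by positivity)]
    simp
  · rw [Finset.mem_Ioc] at hz
    rw [abs_le] at hx ⊢
    push_cast
    omega

lemma le_real_jumpOver (hX : IsIIDWithLaw X stepLaw P) (hY : IsIIDWithLaw Y stepLaw P)
    (hXY : IndepFun (fun ω i => X i ω) (fun ω i => Y i ω) P) {n h : ℕ} {c : ℝ} (hc0 : 0 ≤ c)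
    (hc : ∀ z : ℤ, |z| ≤ (2 * h : ℕ) → ENNReal.ofReal c ≤ hit stepLaw n z) {x y : ℤ}
    (hx : |x| ≤ h) (hy : |y| ≤ h) :
    h * stepLaw.real (Set.Iio (-h : ℤ)) * stepLaw.real {0} * c ^ 2
      ≤ P.real (jumpOver X Y x y h n) := by
  rw [real_jumpOver hXY, measureReal_def P, measureReal_def P, prob_stepEvent hX, prob_stepEvent hY,
    ENNReal.toReal_mul, ENNReal.toReal_mul]
  have h1 : h * c ≤ ((stepOp stepLaw)^[n] (ind (Set.Ioc 0 h)) x).toReal :=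
    (ENNReal.ofReal_le_iff_le_toReal (ne_top_of_le_ne_top ENNReal.one_ne_top
      (stepOp_iterate_le_of_le _ (ind_le_one _) n x))).1 (le_stepOp_iterate_Ioc hc hx)
  have h2 : c ≤ (hit stepLaw n y).toReal :=
    (ENNReal.ofReal_le_iff_le_toReal (ne_top_of_le_ne_top ENNReal.one_ne_top
      (hit_le_one _ n y))).1 (hc y (by push_cast; linarith [abs_nonneg y]))
  calc h * stepLaw.real (Set.Iio (-h : ℤ)) * stepLaw.real {0} * c ^ 2
      = (h * c * stepLaw.real (Set.Iio (-h : ℤ))) * (c * stepLaw.real {0}) := by ring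
    _ ≤ _ := by
      refine mul_le_mul (mul_le_mul_of_nonneg_right h1 measureReal_nonneg)
        (mul_le_mul_of_nonneg_right h2 measureReal_nonneg) ?_ ?_ <;> positivity

lemma real_jumpOver_inter_le (hX : IsIIDWithLaw X stepLaw P) (hY : IsIIDWithLaw Y stepLaw P)
    (hXY : IndepFun (fun ω i => X i ω) (fun ω i => Y i ω) P) {l : ℕ} {c : ℝ} (hc0 : 0 ≤ c)
    (hc : ∀ z, hit stepLaw l z ≤ ENNReal.ofReal c) (x y : ℤ) (h n : ℕ) :
    P.real (jumpOver X Y x y h n ∩ jumpOver X Y x y h (n + 1 + l))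
      ≤ P.real (jumpOver X Y x y h n)
        * (h * stepLaw.real (Set.Iio (-h : ℤ)) * stepLaw.real {0} * c ^ 2) := by
  have hreal : ∀ {p q r : ℝ≥0∞} {t : ℝ}, p ≤ q * (ENNReal.ofReal t * r) → q ≠ ∞ → r ≠ ∞ →
      0 ≤ t → p.toReal ≤ q.toReal * (t * r.toReal) := by
    intro p q r t h1 hq hr ht
    have := ENNReal.toReal_mono
      (ENNReal.mul_ne_top hq (ENNReal.mul_ne_top ENNReal.ofReal_ne_top hr)) h1
    rwa [ENNReal.toReal_mul, ENNReal.toReal_mul, ENNReal.toReal_ofReal ht] at this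
  have h1 := hreal (prob_stepEvent_inter_le hX x (Set.Ioc 0 h) (Set.Iio (-h)) n l
    (stepOp_iterate_Ioc_le hc h)) (measure_ne_top _ _) (measure_ne_top _ _) (by positivity)
  have h2 := hreal (prob_stepEvent_inter_le hY y {0} {0} n l hc) (measure_ne_top _ _)
    (measure_ne_top _ _) hc0
  rw [real_jumpOver_inter hXY, real_jumpOver hXY]
  refine (mul_le_mul h1 h2 ENNReal.toReal_nonneg (by positivity)).trans_eq ?_
  simp only [Measure.real]
  ring

/-- A lower bound for the probability of a crossing in a given window of scales. -/
noncomputable def crossConst : ℝ := 1 / (1 + 2 * (upperConst / lowerConst) ^ 2)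

lemma crossConst_pos : 0 < crossConst := by unfold crossConst; positivity

lemma le_real_iUnion_jumpOver (hX : IsIIDWithLaw X stepLaw P) (hY : IsIIDWithLaw Y stepLaw P)
    (hXY : IndepFun (fun ω i => X i ω) (fun ω i => Y i ω) P) {k : ℕ}
    (hk : 400 * upperConst ^ 2 ≤ scale k)
    (hk' : 16 / (stepLaw.real {0} * lowerConst ^ 2) ≤ scale k) {x y : ℤ}
    (hx : |x| ≤ radius k) (hy : |y| ≤ radius k) :
    crossConst ≤ P.real (⋃ i ∈ Finset.range (2 ^ (scale k ^ 8)),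
      jumpOver X Y x y (radius k) ((i + 1) * scale k ^ 2)) := by
  set J := 2 ^ (scale k ^ 8) with hJ
  set h := radius k with hh
  set lam := h * stepLaw.real (Set.Iio (-h : ℤ)) * stepLaw.real {0} with hlam
  have hd := one_le_scale_real k
  set d : ℝ := (scale k : ℝ) with hd'
  have hd0 : 0 < d := by linarith
  have hlam0 : 0 ≤ lam := by positivity
  have hA : 0 < upperConst := by unfold upperConst; norm_num
  have ha : 0 < lowerConst := by unfold lowerConst; norm_num
  have hp := stepLaw_zero_pos
  have hcast : ∀ i : ℕ, (((i + 1) * scale k ^ 2 : ℕ) : ℝ) = (i + 1) * d ^ 2 := fun i => by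
    push_cast; rfl
  have hsq : ∀ (c : ℝ) (i : ℕ), (c / √((i + 1) * d ^ 2 * d ^ 9)) ^ 2
      = c ^ 2 / d ^ 11 * (1 / ((i : ℝ) + 1)) := fun c i => by
    rw [div_pow, Real.sq_sqrt (by positivity)]
    field_simp
  have hlow : ∀ i ∈ Finset.range J, lam * (lowerConst ^ 2 / d ^ 11 * (1 / ((i : ℝ) + 1)))
      ≤ P.real (jumpOver X Y x y h ((i + 1) * scale k ^ 2)) := by
    intro i hi
    rw [Finset.mem_range] at hi
    have h2 : 4 * ((i + 1) * scale k ^ 2) ≤ scale (k + 1) := by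
      rw [scale, ← hJ]
      calc 4 * ((i + 1) * scale k ^ 2) ≤ 4 * (J * scale k ^ 2) := by gcongr; omega
        _ = _ := by ring
    have := le_real_jumpOver hX hY hXY (n := (i + 1) * scale k ^ 2) (by positivity)
      (fun z hz => le_hit hk (Nat.le_mul_of_pos_left _ (Nat.succ_pos i)) h2 hz) hx hy
    rwa [hcast, hsq] at this
  -- The shift by one makes `b (l + 1)` carry `1/(l + 1)`, so the correlation bound sums to the same
  -- harmonic sum `H` as the mean. Their ratio is then `(upperConst / lowerConst)^2`, independent of
  -- `k`.
  set b : ℕ → ℝ := fun l => lam * (upperConst ^ 2 / d ^ 11 * (1 / (((l - 1 : ℕ) : ℝ) + 1))) with hb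
  have hpair : ∀ i j, i < j → j < J →
      P.real (jumpOver X Y x y h ((i + 1) * scale k ^ 2)
        ∩ jumpOver X Y x y h ((j + 1) * scale k ^ 2))
        ≤ P.real (jumpOver X Y x y h ((i + 1) * scale k ^ 2)) * b (j - i) := by
    intro i j hij _
    obtain ⟨l, rfl⟩ := Nat.exists_eq_add_of_lt hij
    have hpos : 1 ≤ (l + 1) * scale k ^ 2 :=
      Nat.one_le_iff_ne_zero.2 (Nat.mul_ne_zero (Nat.succ_ne_zero l)
        (pow_ne_zero 2 (Nat.one_le_iff_ne_zero.1 (one_le_scale k))))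
    obtain ⟨m, hm⟩ := Nat.exists_eq_add_of_le hpos
    have e1 : (i + l + 1 + 1) * scale k ^ 2 = (i + 1) * scale k ^ 2 + 1 + m := by
      have : (i + l + 1 + 1) * scale k ^ 2 = (i + 1) * scale k ^ 2 + (l + 1) * scale k ^ 2 := by
        ring
      rw [this, hm, add_assoc]
    have e2 : i + l + 1 - i - 1 = l := by omega
    -- One step of the gap is spent on the jump itself, leaving `m` free steps. The `n + 1` in
    -- `hit_le` absorbs exactly this loss.
    have e3 : ((m : ℝ) + 1) = (l + 1) * d ^ 2 := by
      rw [← hcast, hm]; push_cast; ring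
    have hge : scale k ^ 2 ≤ m + 1 := by
      rw [add_comm, ← hm]; exact Nat.le_mul_of_pos_left _ (Nat.succ_pos l)
    have := real_jumpOver_inter_le hX hY hXY (by positivity) (fun z => hit_le hge z) x y h
      ((i + 1) * scale k ^ 2)
    rw [e3, hsq] at this
    simp only [hb, e2]
    rw [e1]
    exact this
  set H := ∑ i ∈ Finset.range J, (1 : ℝ) / (i + 1) with hH
  have hsum_low : lam * (lowerConst ^ 2 / d ^ 11 * H)
      ≤ ∑ i ∈ Finset.range J, P.real (jumpOver X Y x y h ((i + 1) * scale k ^ 2)) := by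
    rw [hH, Finset.mul_sum, Finset.mul_sum]
    exact Finset.sum_le_sum hlow
  have hsum_b : ∑ l ∈ Finset.range J, b (l + 1) = lam * (upperConst ^ 2 / d ^ 11 * H) := by
    rw [hH, Finset.mul_sum, Finset.mul_sum]
    rfl
  refine le_real_iUnion_of_second_moment
    (fun i => (hX.measurableSet_stepEvent _ _ _ _).inter (hY.measurableSet_stepEvent _ _ _ _))
    (b := b) (fun l => by positivity) hpair (by positivity) ?_ ?_
  · rw [hsum_b]
    refine le_trans (le_of_eq ?_) (mul_le_mul_of_nonneg_left hsum_low (by positivity))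
    field_simp
  · refine le_trans ?_ hsum_low
    have hHlow : d ^ 8 / 2 ≤ H := by
      refine le_trans ?_ (log_le_sum_one_div J)
      have h1 : Real.log J ≤ Real.log (J + 1) :=
        Real.log_le_log (by positivity) (by linarith)
      refine le_trans ?_ h1
      rw [hJ, Nat.cast_pow, Real.log_pow, Nat.cast_pow, ← hd']
      have := Real.log_two_gt_d9
      rw [div_eq_mul_inv]
      gcongr
      push_cast
      linarith
    have hlamlow : d ^ 4 / 8 * stepLaw.real {0} ≤ lam := by
      rw [hlam]
      gcongr
      have e : d ^ 4 / 8 = d ^ 5 * (1 / (8 * d)) := by field_simp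
      rw [e, hh]
      refine mul_le_mul (by simp [radius, hd']) (le_stepLaw_Iio k) (by positivity) (by positivity)
    -- The mean number of crossings is at least a constant times `d^4 * d^(-11) * d^8 = d`; `hk'`
    -- makes it at least 1.
    calc (1 : ℝ) ≤ d / (16 / (stepLaw.real {0} * lowerConst ^ 2)) := by
          rwa [one_le_div (by positivity)]
      _ = d ^ 4 / 8 * stepLaw.real {0} * (lowerConst ^ 2 / d ^ 11 * (d ^ 8 / 2)) := by
          field_simp; norm_num
      _ ≤ _ := by gcongr

end Crossing

/-! ### A zero-one law -/

/-- An event whose conditional probabilities along a generating filtration are bounded below has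
probability one. -/
lemma ae_mem_of_forall_le_inter {Ω : Type*} [m0 : MeasurableSpace Ω] {P : Measure Ω}
    [IsProbabilityMeasure P] (ℱ : Filtration ℕ m0) {E : Set Ω} (hE : MeasurableSet[⨆ n, ℱ n] E)
    {c : ℝ} (hc : 0 < c)
    (h : ∀ n (B : Set Ω), MeasurableSet[ℱ n] B → c * P.real B ≤ P.real (B ∩ E)) :
    ∀ᵐ ω ∂P, ω ∈ E := by
  have hE' : MeasurableSet E := (iSup_le fun n => ℱ.le n) _ hE
  set f : Ω → ℝ := E.indicator fun _ => 1
  have hf : Integrable f P := (integrable_const 1).indicator hE'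
  have hfm : StronglyMeasurable[⨆ n, ℱ n] f :=
    (@stronglyMeasurable_const _ _ (⨆ n, ℱ n) _ (1 : ℝ)).indicator hE
  -- On the set `B` where this fails, `c * P.real B ≤ (c / 2) * P.real B`, so `B` is null. By Lévy's
  -- theorem these conditional expectations converge to the indicator of `E`, which therefore cannot
  -- vanish.
  have hlow : ∀ n, ∀ᵐ ω ∂P, c / 2 < (P[f | ℱ n]) ω := by
    intro n
    set B : Set Ω := {ω | (P[f | ℱ n]) ω ≤ c / 2} with hB
    have hBm : MeasurableSet[ℱ n] B :=
      (stronglyMeasurable_condExp (m := ℱ n) (μ := P) (f := f)).measurable measurableSet_Iic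
    have h1 := h n B hBm
    have h2 : P.real (B ∩ E) = ∫ ω in B, (P[f | ℱ n]) ω ∂P := by
      rw [setIntegral_condExp (ℱ.le n) hf hBm, setIntegral_indicator hE', setIntegral_const]
      simp
    have h3 : ∫ ω in B, (P[f | ℱ n]) ω ∂P ≤ ∫ _ in B, c / 2 ∂P :=
      setIntegral_mono_on integrable_condExp.integrableOn (integrable_const _).integrableOn
        (ℱ.le n _ hBm) fun ω hω => hω
    rw [setIntegral_const, smul_eq_mul] at h3
    have h4 : P.real B = 0 := by
      have h5 : 0 ≤ P.real B := measureReal_nonneg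
      nlinarith
    rw [measureReal_eq_zero_iff] at h4
    rw [ae_iff]
    simpa only [not_lt] using h4
  have hlim := hf.tendsto_ae_condExp (ℱ := ℱ) hfm
  filter_upwards [hlim, ae_all_iff.2 hlow] with ω h1 h2
  by_contra hω
  have h3 : f ω = 0 := Set.indicator_of_notMem hω _
  have h4 := ge_of_tendsto' h1 fun n => (h2 n).le
  linarith

/-! ### Shifts and pairs of sequences -/

section Pairs

variable {Ω : Type*} [MeasurableSpace Ω] {P : Measure Ω} {X Y : ℕ → Ω → ℤ} {μ : Measure ℤ}

lemma IsIIDWithLaw.shift (h : IsIIDWithLaw X μ P) (s : ℕ) :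
    IsIIDWithLaw (fun i => X (s + i)) μ P where
  measurable _ := h.measurable _
  indep := h.indep.precomp (g := fun i => s + i) (add_right_injective s)
  law _ := h.law _

lemma indepFun_shift (h : IndepFun (fun ω i => X i ω) (fun ω i => Y i ω) P) (s : ℕ) :
    IndepFun (fun ω i => X (s + i) ω) (fun ω i => Y (s + i) ω) P := by
  have hm : Measurable fun (u : ℕ → ℤ) i => u (s + i) :=
    measurable_pi_lambda _ fun i => measurable_pi_apply _
  exact h.comp hm hm

/-- The sequence of pairs of steps. -/
def pairs (X Y : ℕ → Ω → ℤ) (i : ℕ) (ω : Ω) : ℤ × ℤ := (X i ω, Y i ω)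

lemma iIndepFun_pairs (hX : IsIIDWithLaw X μ P) (hY : IsIIDWithLaw Y μ P)
    (hXY : IndepFun (fun ω i => X i ω) (fun ω i => Y i ω) P) : iIndepFun (pairs X Y) P := by
  rw [iIndepFun_iff_iIndep]
  have hm : ∀ i, Measurable (pairs X Y i) := fun i => (hX.measurable i).prodMk (hY.measurable i)
  refine iIndepSets.iIndep (fun i => (hm i).comap_le)
    (fun i => {s | ∃ t ∈ Set.image2 (· ×ˢ ·) {s : Set ℤ | MeasurableSet s}
      {t : Set ℤ | MeasurableSet t}, pairs X Y i ⁻¹' t = s})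
    (fun i => isPiSystem_prod.comap _) (fun i => ?_) ?_
  · rw [← generateFrom_prod, MeasurableSpace.comap_generateFrom]
    rfl
  · rw [iIndepSets_iff]
    intro s f hf
    have hf' : ∀ i, ∃ A B : Set ℤ, i ∈ s → f i = X i ⁻¹' A ∩ Y i ⁻¹' B := by
      intro i
      by_cases hi : i ∈ s
      · obtain ⟨_, ⟨A, _, B, _, rfl⟩, h⟩ := hf i hi
        exact ⟨A, B, fun _ => h.symm⟩
      · exact ⟨∅, ∅, fun h => absurd h hi⟩
    choose A B hAB using hf'
    have hcyl : ∀ C : ℕ → Set ℤ, MeasurableSet {u : ℕ → ℤ | ∀ i ∈ s, u i ∈ C i} := fun C => by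
      have : {u : ℕ → ℤ | ∀ i ∈ s, u i ∈ C i} = ⋂ i ∈ s, (fun u => u i) ⁻¹' C i := by
        ext u; simp
      rw [this]
      exact Finset.measurableSet_biInter _ fun i _ =>
        measurable_pi_apply i MeasurableSet.of_discrete
    have h1 : ⋂ i ∈ s, f i = (fun ω i => X i ω) ⁻¹' {u | ∀ i ∈ s, u i ∈ A i}
        ∩ (fun ω i => Y i ω) ⁻¹' {u | ∀ i ∈ s, u i ∈ B i} := by
      have : ⋂ i ∈ s, f i = ⋂ i ∈ s, (X i ⁻¹' A i ∩ Y i ⁻¹' B i) :=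
        Set.iInter₂_congr hAB
      rw [this]
      ext ω
      simp only [Set.mem_iInter, Set.mem_inter_iff, Set.mem_preimage, Set.mem_ofPred_eq]
      exact forall₂_and
    have h2 : ∀ (Z : ℕ → Ω → ℤ) (C : ℕ → Set ℤ),
        (fun ω i => Z i ω) ⁻¹' {u | ∀ i ∈ s, u i ∈ C i} = ⋂ i ∈ s, Z i ⁻¹' C i := fun Z C => by
      ext ω; simp
    have h3 : ∀ i ∈ s, P (f i) = P (X i ⁻¹' A i) * P (Y i ⁻¹' B i) := by
      intro i hi
      rw [hAB i hi]
      have hi' : IndepFun (X i) (Y i) P := hXY.comp (measurable_pi_apply i) (measurable_pi_apply i)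
      exact hi'.measure_inter_preimage_eq_mul _ _ MeasurableSet.of_discrete
        MeasurableSet.of_discrete
    rw [h1, hXY.measure_inter_preimage_eq_mul _ _ (hcyl A) (hcyl B), h2, h2,
      hX.indep.measure_inter_preimage_eq_mul s fun _ _ => MeasurableSet.of_discrete,
      hY.indep.measure_inter_preimage_eq_mul s fun _ _ => MeasurableSet.of_discrete,
      Finset.prod_congr rfl h3, Finset.prod_mul_distrib]

/-! ### Crossings infinitely often -/

/-- The step from `p` to `q` crosses zero in the first coordinate and stays at zero in the
second one. -/
def Crosses (p q : ℤ × ℤ) : Prop := p.1 * q.1 < 0 ∧ p.2 = 0 ∧ q.2 = 0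

/-- The starting points and step sequences of planar walks with a crossing at time `n`. -/
def crossAt (n : ℕ) : Set ((ℤ × ℤ) × (ℕ → ℤ × ℤ)) :=
  {a | Crosses (a.1 + ∑ i ∈ Finset.range n, a.2 i) (a.1 + ∑ i ∈ Finset.range (n + 1), a.2 i)}

/-- The starting points and step sequences of planar walks with infinitely many crossings. -/
def crossOften : Set ((ℤ × ℤ) × (ℕ → ℤ × ℤ)) := {a | ∃ᶠ n in atTop, a ∈ crossAt n}

lemma measurableSet_crossAt (n : ℕ) : MeasurableSet (crossAt n) := by
  have h : ∀ n, Measurable fun a : (ℤ × ℤ) × (ℕ → ℤ × ℤ) =>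
      a.1 + ∑ i ∈ Finset.range n, a.2 i := fun n =>
    measurable_fst.add (Finset.measurable_sum _ fun i _ =>
      (measurable_pi_apply i).comp measurable_snd)
  exact ((h n).prodMk (h (n + 1)))
    (MeasurableSet.of_discrete (s := {b : (ℤ × ℤ) × (ℤ × ℤ) | Crosses b.1 b.2}))

lemma crossOften_eq : crossOften = ⋂ N, ⋃ n ≥ N, crossAt n := by
  ext a
  simp only [crossOften, Set.mem_ofPred_eq, frequently_atTop, Set.mem_iInter, Set.mem_iUnion,
    exists_prop]

lemma measurableSet_crossOften : MeasurableSet crossOften := by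
  rw [crossOften_eq]
  exact MeasurableSet.iInter fun N => MeasurableSet.iUnion fun n => MeasurableSet.iUnion fun _ =>
    measurableSet_crossAt n

/-- Infinitely many crossings is a tail property once the current position is taken as the new
starting point. This is why the starting point is part of the data. -/
lemma crossOften_shift (z : ℤ × ℤ) (u : ℕ → ℤ × ℤ) (s : ℕ) :
    (z, u) ∈ crossOften
      ↔ (z + ∑ i ∈ Finset.range s, u i, fun i => u (s + i)) ∈ crossOften := by
  have h : ∀ n, (z + ∑ i ∈ Finset.range s, u i, fun i => u (s + i)) ∈ crossAt n
      ↔ (z, u) ∈ crossAt (n + s) := fun n => by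
    simp only [crossAt, Set.mem_ofPred_eq]
    rw [add_assoc, add_assoc, ← Finset.sum_range_add, ← Finset.sum_range_add,
      show n + s + 1 = s + (n + 1) by ring, show n + s = s + n by ring]
  simp only [crossOften, Set.mem_ofPred_eq, h]
  rw [← map_add_atTop_eq_nat s, frequently_map]
  simp only [map_add_atTop_eq_nat]

lemma sum_pairs (n : ℕ) (ω : Ω) :
    ∑ i ∈ Finset.range n, pairs X Y i ω = (walk X n ω, walk Y n ω) := by
  simp only [pairs, walk]
  rw [Prod.ext_iff]
  simp [Prod.fst_sum, Prod.snd_sum]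

lemma mem_crossAt_iff (z : ℤ × ℤ) (n : ℕ) (ω : Ω) :
    (z, fun i => pairs X Y i ω) ∈ crossAt n
      ↔ (z.1 + walk X n ω) * (z.1 + walk X (n + 1) ω) < 0
        ∧ z.2 + walk Y n ω = 0 ∧ z.2 + walk Y (n + 1) ω = 0 := by
  simp only [crossAt, Set.mem_ofPred_eq, sum_pairs, Crosses, Prod.fst_add, Prod.snd_add]

lemma jumpOver_subset_crossAt (x y : ℤ) (h n : ℕ) :
    jumpOver X Y x y h n ⊆ {ω | ((x, y), fun i => pairs X Y i ω) ∈ crossAt n} := by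
  rintro ω ⟨⟨h1, h2⟩, h3, h4⟩
  rw [Set.mem_ofPred_eq, mem_crossAt_iff]
  simp only [Set.mem_Ioc, Set.mem_Iio, Set.mem_singleton_iff] at h1 h2 h3 h4
  simp only [walk_succ, ← add_assoc]
  refine ⟨mul_neg_of_pos_of_neg h1.1 (by linarith [h1.2]), h3, by rw [h3, h4, add_zero]⟩

lemma measurable_pairs (hX : IsIIDWithLaw X μ P) (hY : IsIIDWithLaw Y μ P) :
    Measurable fun ω i => pairs X Y i ω :=
  measurable_pi_lambda _ fun i => (hX.measurable i).prodMk (hY.measurable i)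

lemma indepFun_walk (hXY : IndepFun (fun ω i => X i ω) (fun ω i => Y i ω) P) (n m : ℕ) :
    IndepFun (walk X n) (walk Y m) P := by
  have hm : ∀ n, Measurable fun u : ℕ → ℤ => ∑ i ∈ Finset.range n, u i := fun n =>
    Finset.measurable_sum _ fun i _ => measurable_pi_apply i
  exact hXY.comp (hm n) (hm m)

variable [IsProbabilityMeasure P]

/-- For each `N`, a scale exceeding `N` and both coordinates of `z` supplies a crossing after time
`N` with the same probability bound. Continuity from above then passes to the limsup. -/
lemma le_real_crossOften (hX : IsIIDWithLaw X stepLaw P) (hY : IsIIDWithLaw Y stepLaw P)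
    (hXY : IndepFun (fun ω i => X i ω) (fun ω i => Y i ω) P) (z : ℤ × ℤ) :
    crossConst ≤ P.real {ω | (z, fun i => pairs X Y i ω) ∈ crossOften} := by
  have hm : Measurable fun ω => (z, fun i => pairs X Y i ω) :=
    measurable_const.prodMk (measurable_pairs hX hY)
  set G : ℕ → Set Ω := fun N => ⋃ n ≥ N, {ω | (z, fun i => pairs X Y i ω) ∈ crossAt n} with hG
  have hGm : ∀ N, MeasurableSet (G N) := fun N => MeasurableSet.iUnion fun n =>
    MeasurableSet.iUnion fun _ => hm (measurableSet_crossAt n)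
  have hGanti : Antitone G := fun N M hNM =>
    Set.biUnion_mono (fun n hn => le_trans hNM hn) fun _ _ => le_rfl
  have hset : {ω | (z, fun i => pairs X Y i ω) ∈ crossOften} = ⋂ N, G N := by
    ext ω
    simp only [crossOften_eq, hG, Set.mem_ofPred_eq, Set.mem_iInter, Set.mem_iUnion]
  have hlow : ∀ N, crossConst ≤ P.real (G N) := by
    intro N
    have hev : ∀ C : ℝ, ∀ᶠ k in atTop, C ≤ (scale k : ℝ) := fun C =>
      (tendsto_natCast_atTop_atTop.comp tendsto_scale).eventually_ge_atTop C
    obtain ⟨k, h1, h2, h3, h4, h5⟩ := ((hev (400 * upperConst ^ 2)).and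
      ((hev (16 / (stepLaw.real {0} * lowerConst ^ 2))).and
        ((tendsto_scale.eventually_ge_atTop N).and
          ((tendsto_scale.eventually_ge_atTop z.1.natAbs).and
            (tendsto_scale.eventually_ge_atTop z.2.natAbs))))).exists
    have hrad : scale k ≤ radius k := Nat.le_self_pow (by norm_num) _
    refine (le_real_iUnion_jumpOver hX hY hXY h1 h2 (x := z.1) (y := z.2) 
      (by rw [Int.abs_eq_natAbs]; exact_mod_cast h4.trans hrad)
      (by rw [Int.abs_eq_natAbs]; exact_mod_cast h5.trans hrad)).trans (measureReal_mono ?_ (measure_ne_top _ _))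
    refine Set.iUnion₂_subset fun i _ => (jumpOver_subset_crossAt _ _ _ _).trans ?_
    refine Set.subset_biUnion_of_mem (u := fun n => {ω | (z, fun i => pairs X Y i ω) ∈ crossAt n})
      (show N ≤ (i + 1) * scale k ^ 2 from ?_)
    calc N ≤ scale k := h3
      _ ≤ scale k ^ 2 := Nat.le_self_pow two_ne_zero _
      _ ≤ (i + 1) * scale k ^ 2 := Nat.le_mul_of_pos_left _ (Nat.succ_pos i)
  rw [hset]
  have ht := tendsto_measure_iInter_atTop (μ := P) (fun N => (hGm N).nullMeasurableSet) hGanti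
    ⟨0, measure_ne_top _ _⟩
  have ht' := (ENNReal.tendsto_toReal (measure_ne_top P _)).comp ht
  exact ge_of_tendsto' ht' hlow

/-- Given the first `s` steps, the rest is a fresh planar walk from the current position, and
`le_real_crossOften` is uniform in that position. -/
lemma crossConst_mul_le (hX : IsIIDWithLaw X stepLaw P) (hY : IsIIDWithLaw Y stepLaw P)
    (hXY : IndepFun (fun ω i => X i ω) (fun ω i => Y i ω) P) (s : ℕ) {B : Set Ω}
    (hB : MeasurableSet[past (pairs X Y) s] B) :
    crossConst * P.real B ≤ P.real (B ∩ {ω | (0, fun i => pairs X Y i ω) ∈ crossOften}) := by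
  have hpm : ∀ i, Measurable (pairs X Y i) := fun i => (hX.measurable i).prodMk (hY.measurable i)
  have hB' : MeasurableSet B := past_le hpm s _ hB
  set E := {ω | ((0 : ℤ × ℤ), fun i => pairs X Y i ω) ∈ crossOften} with hE
  have hEm : MeasurableSet E :=
    (measurable_const.prodMk (measurable_pairs hX hY)) measurableSet_crossOften
  set U : Ω → ℝ≥0∞ × (ℤ × ℤ) :=
    fun ω => (B.indicator 1 ω, ∑ i ∈ Finset.range s, pairs X Y i ω) with hU
  set V : Ω → ℕ → ℤ × ℤ := fun ω i => pairs X Y (s + i) ω with hV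
  have hUm : Measurable[past (pairs X Y) s] U := by
    refine Measurable.prodMk ((measurable_const (a := (1 : ℝ≥0∞))).indicator hB) ?_
    exact @Finset.measurable_sum _ _ _ _ _ _ (past (pairs X Y) s) _ _
      fun i hi => measurable_past (Finset.mem_range.1 hi)
  have hVm : Measurable[future (pairs X Y) s] V :=
    @measurable_pi_lambda _ _ _ (future (pairs X Y) s) _ _
      fun i => measurable_future (Nat.le_add_right s i)
  have hVm' : Measurable V := measurable_pi_lambda _ fun i => hpm (s + i)
  have hind := indepFun_past_future hpm (iIndepFun_pairs hX hY hXY) hUm hVm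
  have key := lintegral_indepFun (hUm.mono (past_le hpm s) le_rfl) hVm' hind
    (g := fun u v => u.1 * crossOften.indicator 1 (u.2, v)) (by
      exact measurable_fst.fst.mul ((measurable_one.indicator measurableSet_crossOften).comp
        (measurable_fst.snd.prodMk measurable_snd)))
  have hleft : ∫⁻ ω, (U ω).1 * crossOften.indicator 1 ((U ω).2, V ω) ∂P = P (B ∩ E) := by
    rw [← lintegral_indicator_one (hB'.inter hEm)]
    refine lintegral_congr fun ω => ?_
    have h1 : ((U ω).2, V ω) ∈ crossOften ↔ ω ∈ E := by
      rw [hE, Set.mem_ofPred_eq, crossOften_shift 0 _ s, zero_add]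
    have h2 : crossOften.indicator (1 : (ℤ × ℤ) × (ℕ → ℤ × ℤ) → ℝ≥0∞) ((U ω).2, V ω)
        = E.indicator 1 ω := by
      by_cases h3 : ω ∈ E
      · rw [Set.indicator_of_mem h3, Set.indicator_of_mem (h1.2 h3)]; rfl
      · rw [Set.indicator_of_notMem h3, Set.indicator_of_notMem fun h4 => h3 (h1.1 h4)]
    rw [h2, Set.inter_indicator_one]
    rfl
  have hinner : ∀ z : ℤ × ℤ, ENNReal.ofReal crossConst
      ≤ ∫⁻ v, crossOften.indicator 1 (z, v) ∂(P.map V) := by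
    intro z
    have hmz : Measurable fun v : ℕ → ℤ × ℤ => crossOften.indicator (1 : (ℤ × ℤ) × (ℕ → ℤ × ℤ) → ℝ≥0∞) (z, v) :=
      (measurable_one.indicator measurableSet_crossOften).comp (measurable_const.prodMk measurable_id)
    rw [lintegral_map hmz hVm']
    have h1 := le_real_crossOften (hX.shift s) (hY.shift s) (indepFun_shift hXY s) z
    have h2 := (ENNReal.ofReal_le_iff_le_toReal (measure_ne_top _ _)).2 h1
    refine h2.trans_eq ?_
    exact (lintegral_indicator_one
      ((measurable_const.prodMk (measurable_pairs (hX.shift s) (hY.shift s)))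
        measurableSet_crossOften)).symm
  have hfinal : P B * ENNReal.ofReal crossConst ≤ P (B ∩ E) := by
    rw [← hleft, key, ← lintegral_indicator_one hB',
      ← lintegral_mul_const _ (measurable_one.indicator hB')]
    refine lintegral_mono fun ω => ?_
    have hmz : Measurable fun v : ℕ → ℤ × ℤ =>
        crossOften.indicator (1 : (ℤ × ℤ) × (ℕ → ℤ × ℤ) → ℝ≥0∞) ((U ω).2, v) :=
      (measurable_one.indicator measurableSet_crossOften).comp (measurable_const.prodMk measurable_id)
    rw [lintegral_const_mul _ hmz]
    exact mul_le_mul' le_rfl (hinner _)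
  have := ENNReal.toReal_mono (measure_ne_top _ _) hfinal
  rw [ENNReal.toReal_mul, ENNReal.toReal_ofReal crossConst_pos.le] at this
  rw [mul_comm]
  exact this

lemma ae_crossOften (hX : IsIIDWithLaw X stepLaw P) (hY : IsIIDWithLaw Y stepLaw P)
    (hXY : IndepFun (fun ω i => X i ω) (fun ω i => Y i ω) P) :
    ∀ᵐ ω ∂P, (0, fun i => pairs X Y i ω) ∈ crossOften := by
  have hpm : ∀ i, Measurable (pairs X Y i) := fun i => (hX.measurable i).prodMk (hY.measurable i)
  let ℱ : Filtration ℕ ‹MeasurableSpace Ω› := ⟨past (pairs X Y), past_mono, past_le hpm⟩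
  refine ae_mem_of_forall_le_inter ℱ
    (E := {ω | ((0 : ℤ × ℤ), fun i => pairs X Y i ω) ∈ crossOften}) ?_ crossConst_pos
    fun n B hB => crossConst_mul_le hX hY hXY n hB
  have h1 : Measurable[⨆ n, ℱ n] fun ω i => pairs X Y i ω :=
    @measurable_pi_lambda _ _ _ (⨆ n, ℱ n) _ _ fun i =>
      (measurable_past (X := pairs X Y) (Nat.lt_succ_self i)).mono
        (le_iSup (fun n => ℱ n) (i + 1)) le_rfl
  exact (Measurable.prodMk (@measurable_const _ _ _ (⨆ n, ℱ n) (0 : ℤ × ℤ)) h1)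
    measurableSet_crossOften

lemma ae_frequently_crossing (hX : IsIIDWithLaw X stepLaw P) (hY : IsIIDWithLaw Y stepLaw P)
    (hXY : IndepFun (fun ω i => X i ω) (fun ω i => Y i ω) P) :
    ∀ᵐ ω ∂P, ∃ᶠ n in atTop,
      walk X n ω * walk X (n + 1) ω < 0 ∧ walk Y n ω = 0 ∧ walk Y (n + 1) ω = 0 := by
  filter_upwards [ae_crossOften hX hY hXY] with ω hω
  refine Frequently.mono hω fun n hn => ?_
  simpa [mem_crossAt_iff] using hn

/-! ### Transience and the two series -/

lemma prob_walk_eq_zero (hX : IsIIDWithLaw X stepLaw P) (n : ℕ) :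
    P {ω | walk X n ω = 0} = hit stepLaw n 0 := by
  rw [hit, ← prob_walk_mem hX]
  simp

lemma prob_walk_eq_le (hX : IsIIDWithLaw X stepLaw P) (n : ℕ) (z : ℤ) :
    P {ω | walk X n ω = z} ≤ hit stepLaw n 0 := by
  refine le_trans (le_of_eq ?_) ((isUnimodal_hit n).le_zero (-z))
  rw [hit, ← prob_walk_mem hX]
  simp [neg_add_eq_zero, eq_comm]

lemma isTransient_walk (hX : IsIIDWithLaw X stepLaw P) (hY : IsIIDWithLaw Y stepLaw P)
    (hXY : IndepFun (fun ω i => X i ω) (fun ω i => Y i ω) P) :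
    IsTransient (fun n ω => (walk X n ω, walk Y n ω)) P := by
  intro B hB
  have hfin : B.Finite := hB.isCompact_closure.finite_of_discrete.subset subset_closure
  have hpoint : ∀ z : ℤ × ℤ, ∀ᵐ ω ∂P, {n : ℕ | (walk X n ω, walk Y n ω) = z}.Finite := by
    intro z
    refine ae_finite_setOfPred_mem (s := fun n => {ω | (walk X n ω, walk Y n ω) = z}) ?_
    refine ne_top_of_le_ne_top tsum_hit_sq_lt_top.ne (ENNReal.tsum_le_tsum fun n => ?_)
    have h1 : {ω | (walk X n ω, walk Y n ω) = z} = walk X n ⁻¹' {z.1} ∩ walk Y n ⁻¹' {z.2} := by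
      ext ω; simp [Prod.ext_iff]
    rw [h1, (indepFun_walk hXY n n).measure_inter_preimage_eq_mul _ _ (MeasurableSet.singleton _)
      (MeasurableSet.singleton _), sq]
    exact mul_le_mul' (prob_walk_eq_le hX n z.1) (prob_walk_eq_le hY n z.2)
  filter_upwards [(ae_ball_iff hfin.countable).2 fun z _ => hpoint z] with ω hω
  refine (hfin.biUnion hω).subset fun n hn => ?_
  exact Set.mem_biUnion (x := (walk X n ω, walk Y n ω)) hn rfl

lemma tsum_prob_walk_eq_zero_sq (hX : IsIIDWithLaw X stepLaw P) :
    ∑' n : ℕ, P {ω | walk X (n + 1) ω = 0} ^ 2 < ⊤ := by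
  simp only [prob_walk_eq_zero hX]
  exact lt_of_le_of_lt (ENNReal.tsum_comp_le_tsum_of_injective (add_left_injective 1)
    fun n => hit stepLaw n 0 ^ 2) tsum_hit_sq_lt_top

/-- Each term is the probability that one walk crosses while the independent other one is at zero. A
finite sum would, by Borel–Cantelli, contradict the infinitely many crossings. -/
lemma tsum_prob_crossing (hX : IsIIDWithLaw X stepLaw P) (hY : IsIIDWithLaw Y stepLaw P)
    (hXY : IndepFun (fun ω i => X i ω) (fun ω i => Y i ω) P) :
    ∑' n : ℕ, P {ω | walk X (n + 1) ω = 0} * P {ω | walk X (n + 1) ω * walk X (n + 2) ω < 0}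
      = ⊤ := by
  by_contra hne
  have hm : ∀ n, Measurable fun u : ℕ → ℤ => ∑ i ∈ Finset.range n, u i := fun n =>
    Finset.measurable_sum _ fun i _ => measurable_pi_apply i
  have hle : ∀ n, P {ω | walk X (n + 1) ω * walk X (n + 2) ω < 0 ∧ walk Y (n + 1) ω = 0}
      = P {ω | walk X (n + 1) ω = 0} * P {ω | walk X (n + 1) ω * walk X (n + 2) ω < 0} := by
    intro n
    have hi : IndepFun (fun ω => (walk X (n + 1) ω, walk X (n + 2) ω)) (walk Y (n + 1)) P :=
      hXY.comp ((hm (n + 1)).prodMk (hm (n + 2))) (hm (n + 1))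
    have := hi.measure_inter_preimage_eq_mul {p : ℤ × ℤ | p.1 * p.2 < 0} {0}
      MeasurableSet.of_discrete MeasurableSet.of_discrete
    rw [prob_walk_eq_zero hX, ← prob_walk_eq_zero hY, mul_comm]
    exact this
  have hfin : ∀ᵐ ω ∂P, {n : ℕ | walk X (n + 1) ω * walk X (n + 2) ω < 0
      ∧ walk Y (n + 1) ω = 0}.Finite := by
    refine ae_finite_setOfPred_mem
      (s := fun n => {ω | walk X (n + 1) ω * walk X (n + 2) ω < 0 ∧ walk Y (n + 1) ω = 0}) ?_
    simpa only [hle] using hne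
  obtain ⟨ω, h1, h2⟩ := (hfin.and (ae_frequently_crossing hX hY hXY)).exists
  rw [← map_add_atTop_eq_nat 1, frequently_map] at h2
  exact (Nat.frequently_atTop_iff_infinite.1 (h2.mono fun n hn => ⟨hn.1, hn.2.1⟩)) h1

end Pairs

theorem theorem3 :
    ∃ μ : Measure ℤ, IsProbabilityMeasure μ ∧ μ.IsNegInvariant ∧
      ∀ (Ω : Type*) [MeasurableSpace Ω] (P : Measure Ω) [IsProbabilityMeasure P]
        (X Y : ℕ → Ω → ℤ), IsIIDWithLaw X μ P → IsIIDWithLaw Y μ P →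
        IndepFun (fun ω i => X i ω) (fun ω i => Y i ω) P →
        IsTransient (fun n ω => (walk X n ω, walk Y n ω)) P ∧
        (∀ᵐ ω ∂P, ∃ᶠ n in atTop,
          walk X n ω * walk X (n + 1) ω < 0 ∧ walk Y n ω = 0 ∧ walk Y (n + 1) ω = 0) ∧
        (∑' n : ℕ, P {ω | walk X (n + 1) ω = 0} ^ 2 < ⊤) ∧
        (∑' n : ℕ, P {ω | walk X (n + 1) ω = 0} *
          P {ω | walk X (n + 1) ω * walk X (n + 2) ω < 0} = ⊤) :=
  ⟨stepLaw, inferInstance, mixture_isNegInvariant _ _, fun _ _ _ _ _ _ hX hY hXY =>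
    ⟨isTransient_walk hX hY hXY, ae_frequently_crossing hX hY hXY,
      tsum_prob_walk_eq_zero_sq hX, tsum_prob_crossing hX hY hXY⟩⟩
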